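/- **Setting.** Let $d,n\ge 1$, let $\underline K^j<\overline K^j$ ($j=1,\dots,d$) be real numbers, put $V=\prod_{j=1}^d[\underline K^j,\overline K^j]$, $\Omega_i=V^i\subset\mathbb R^{id}$ and $\Omega=\Omega_n$, and let $S=(S_{t_1},\dots,S_{t_n})$ be the canonical process on $\Omega$ (with values in $V$), with a deterministic initial value $S_{t_0}\in V$. For $i=0,\dots,n$ and $j=1,\dots,d$ let $c^{\rm trans}_{i,j},c^{\rm spread}_{i,j},c^{\rm short}_{i,j}:\mathbb R\times\mathbb R\to[0,\infty)$ be measurable, with $c^{\rm short}_{i,j}(s,x)=0$ for $x>0$. A strategy $\Delta=(\Delta_i^j)_{0\le i\le n-1,\,1\le j\le d}$ consists of constants $\Delta_0^j$ and functions $\Delta_i^j:\mathbb R^{id}\to\mathbb R$. With $\Delta_i^j=\Delta_i^j(S_{t_1},\dots,S_{t_i})$ and the convention $\Delta_{-1}^j=\Delta_n^j=0$, let $$h_{c,\Delta}=c+\sum_{j=1}^d\sum_{i=0}^{n-1}\Delta_i^j\,(S^j_{t_{i+1}}-S^j_{t_i})-\sum_{j=1}^d\sum_{i=0}^{n}\Big[c^{\rm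 trans}_{i,j}(S^j_{t_i},\Delta_i^j-\Delta_{i-1}^j)+c^{\rm spread}_{i,j}(S^j_{t_i},\Delta_i^j-\Delta_{i-1}^j)+c^{\rm short}_{i,j}(S^j_{t_i},\Delta_i^j)\Big].$$ For $B,L>0$ let $\mathcal H_{B,L}$ be the set of all $h_{c,\Delta}$ with $|c|\le B$, $|\Delta_0^j|\le B$ and, for $1\le i\le n-1$, $\Delta_i^j$ $L$-Lipschitz for the Euclidean norm with $|\Delta_i^j|\le B$ on $\Omega_i$. For an activation function $\varphi:\mathbb R\to\mathbb R$ let $\mathcal H^{NN}_{B,L}\subseteq\mathcal H_{B,L}$ be the set of those $h_{c,\Delta}$ for which in addition, for every $1\le i\le n-1$, $(\Delta_i^1,\dots,\Delta_i^d)$ coincides on $\Omega_i$ with a feed-forward neural network $\mathbb R^{id}\to\mathbb R^d$ with activation $\varphi$ (any number $\ge 1$ of hidden layers, any widths) whose components are $L$-Lipschitz and bounded by $B$ on $\Omega_i$. Let $\mathcal P$ be a finite set of Borel probability measures on $\Omega$ and $\beta:\mathbb R\to[0,\infty)$. For a $\sigma$-algebra $\mathcal G\subseteq\sigma(S)$,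 a bounded Borel function $\Phi:\Omega\to\mathbb R$ and $k\in\mathbb N$ put, with $\inf\emptyset=+\infty$, $$\Gamma_{B,L}(\Phi,\mathcal G)=\inf\big\{c : h_{c,\Delta}\in\mathcal H_{B,L},\ \mathbb E_{\mathbb P}[h_{c,\Delta}\mid\mathcal G]\ge\mathbb E_{\mathbb P}[\Phi\mid\mathcal G]\ \ \mathbb P\text{-a.s. for all }\mathbb P\in\mathcal P\big\},$$ $$\Gamma^{NN}_{B,L,k}(\Phi,\mathcal G)=\inf_{h_{c,\Delta}\in\mathcal H^{NN}_{B,L}}\Big\{c+k\sum_{\mathbb P\in\mathcal P}\int_\Omega\beta\big(\mathbb E_{\mathbb P}[\Phi-h_{c,\Delta}\mid\mathcal G]\big)\,d\mathbb P\Big\}.$$ Let $U=(a^{(i)}_j,b^{(i)}_j)_{i\ge1,\,1\le j\le d}$ with $a^{(i)}_j$ independent and uniform on $[\underline K^j,\overline K^j]$ and $b^{(i)}_j=\overline K^j$, let $\mathbf P^U$ be its law, and $A_i=\prod_{j}(a^{(i)}_j,b^{(i)}_j]\cap V$. Put $\mathcal E_0=\{\emptyset,V\}$, $\mathcal E_i=\{E\cap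 A_i,\,E\setminus A_i: E\in\mathcal E_{i-1}\}$ and $\mathcal F_i=\{S_{t_n}^{-1}(A): A\in\sigma(\mathcal E_i)\}$. **Theorem 2.9.** Assume that 1. for all $i,j,s$ the functions $x\mapsto c^{\rm trans}_{i,j}(s,x)$, $c^{\rm spread}_{i,j}(s,x)$, $c^{\rm short}_{i,j}(s,x)$ are continuous, and for every $R>0$ all cost functions are bounded on $[\underline K^j,\overline K^j]\times[-R,R]$ (as is the case if they are jointly continuous); 2. $\mathcal P$ is finite and, if $d\ge2$, $\mathbb P(S^j_{t_n}=\underline K^j)=0$ for all $\mathbb P\in\mathcal P$ and all $j$; 3. $\beta$ is continuous and convex, $\beta(x)=0$ for $x\le0$ and $\beta(x)>0$ for $x>0$; 4. $\varphi$ is continuously differentiable and not a polynomial, or $\varphi(x)=\max\{x,0\}$. Then for all $B,L>0$ and every Borel measurable $\Phi:\Omega\to\mathbb R$ with $\sup_\Omega|\Phi|\le B$, for $\mathbf P^U$-almost every realization of $U$: for every $k\in\mathbb N$ the limit $\lim_{i\to\infty}\Gamma^{NN}_{B,L,k}(\Phi,\mathcal F_i)$ exists and is finite, and $$\Gamma_{B,L}(\Phi,\sigma(S_{t_n}))=\lim_{k\to\infty}\lim_{i\to\infty}\Gamma^{NN}_{B,L,k}(\Phi,\mathcal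 F_i)\quad\text{in }(-\infty,+\infty].$$ -/

import Mathlib

open MeasureTheory ProbabilityTheory Filter Topology

noncomputable section

/-- `E_P[h | 𝒢] ≥ E_P[Φ | 𝒢]` holds `P`-almost surely. (`m₀` is the `σ`-algebra of the space `Ω`,
on which `P` lives, and `𝒢` the conditioning one.) -/
def CondDominates {Ω : Type} (𝒢 : MeasurableSpace Ω) {m₀ : MeasurableSpace Ω}
    (P : ProbabilityMeasure Ω) (h Φ : Ω → ℝ) : Prop :=
  P.toMeasure[Φ | 𝒢] ≤ᵐ[P.toMeasure] P.toMeasure[h | 𝒢]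

/-- The penalty `∫ β(E_P[X | 𝒢]) dP`. -/
def condPenalty {Ω : Type} (β : ℝ → ℝ) (𝒢 : MeasurableSpace Ω) {m₀ : MeasurableSpace Ω}
    (P : ProbabilityMeasure Ω) (X : Ω → ℝ) : ℝ :=
  ∫ x, β ((P.toMeasure[X | 𝒢]) x) ∂P.toMeasure

/-- The box `[K₁, K̄₁] × ⋯ × [K_d, K̄_d]` of possible values of `d` securities. -/
abbrev PriceBox {d : ℕ} (lo hi : Fin d → ℝ) : Type :=
  (j : Fin d) → Set.Icc (lo j) (hi j)

/-- A market with `d` securities traded at the times `t₀ < t₁ < ⋯ < tₙ`: the price bounds, the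
deterministic spot prices at `t₀`, and the cost functions `c i j s x` (`i = 0, …, n` the time,
`j` the security, `s` its price, `x` the change of the position, or the held position for the
borrowing costs). -/
structure Market (d n : ℕ) where
  lo : Fin d → ℝ
  hi : Fin d → ℝ
  lo_lt_hi : ∀ j, lo j < hi j
  spot : PriceBox lo hi
  cTrans : Fin (n + 1) → Fin d → ℝ → ℝ → ℝ
  cSpread : Fin (n + 1) → Fin d → ℝ → ℝ → ℝ
  cShort : Fin (n + 1) → Fin d → ℝ → ℝ → ℝ
  cTrans_measurable : ∀ i j, Measurable (Function.uncurry (cTrans i j))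
  cSpread_measurable : ∀ i j, Measurable (Function.uncurry (cSpread i j))
  cShort_measurable : ∀ i j, Measurable (Function.uncurry (cShort i j))
  cTrans_nonneg : ∀ i j s x, 0 ≤ cTrans i j s x
  cSpread_nonneg : ∀ i j s x, 0 ≤ cSpread i j s x
  cShort_nonneg : ∀ i j s x, 0 ≤ cShort i j s x
  /-- A long position causes no borrowing costs. -/
  cShort_long : ∀ i j s x, 0 < x → cShort i j s x = 0

/-- A trading strategy `Δ`: the position `Δ i j` held in security `j` from time `tᵢ` on is a
function on `ℝ^{id}` of the prices at `t₁, …, tᵢ`; for `i = 0` it is a constant, since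
`ℝ^0` is a single point. -/
abbrev Strategy (d n : ℕ) : Type :=
  (i : Fin n) → Fin d → EuclideanSpace ℝ (Fin (i : ℕ) × Fin d) → ℝ

namespace Market

variable {d n : ℕ} (M : Market d n)

/-- The path space `Ω` of the prices at the times `t₁, …, tₙ`, with its Borel `σ`-algebra. -/
abbrev Omega : Type := Fin n → PriceBox M.lo M.hi

/-- The set `Ωᵢ ⊆ ℝ^{id}` of price histories up to time `tᵢ`. -/
def histories (i : ℕ) : Set (EuclideanSpace ℝ (Fin i × Fin d)) :=
  {y | ∀ p, y p ∈ Set.Icc (M.lo p.2) (M.hi p.2)}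

/-- The prices `S_{tᵢ}`, `i = 0, …, n`, along a path. -/
def price (x : M.Omega) : Fin (n + 1) → PriceBox M.lo M.hi :=
  Fin.cons M.spot x

/-- The terminal value `S_{tₙ}`. -/
def terminal (x : M.Omega) : PriceBox M.lo M.hi := M.price x (Fin.last n)

/-- The `σ`-algebra `σ(S_{tₙ})` on `Ω`. -/
abbrev terminalSigma : MeasurableSpace M.Omega :=
  MeasurableSpace.comap M.terminal inferInstance

/-- The history `(S_{t₁}, …, S_{tᵢ})` of a path, as a vector of `ℝ^{id}`. -/
def history (x : M.Omega) {i : ℕ} (hi : i ≤ n) : EuclideanSpace ℝ (Fin i × Fin d) :=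
  WithLp.toLp 2 fun p => (x (Fin.castLE hi p.1) p.2 : ℝ)

/-- The position in security `j` after trading at time `tᵢ`, with the convention `Δₙ = 0`. -/
def position (Δ : Strategy d n) (x : M.Omega) (j : Fin d) (i : ℕ) : ℝ :=
  if h : i < n then Δ ⟨i, h⟩ j (M.history x h.le) else 0

/-- The position in security `j` before trading at time `tᵢ`, with the convention `Δ₋₁ = 0`. -/
def prevPosition (Δ : Strategy d n) (x : M.Omega) (j : Fin d) : ℕ → ℝ
  | 0 => 0
  | i + 1 => M.position Δ x j i

/-- The gross profit `(Δ · S)ₙ`. -/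
def grossProfit (Δ : Strategy d n) (x : M.Omega) : ℝ :=
  ∑ j : Fin d, ∑ i : Fin n,
    M.position Δ x j i * ((M.price x i.succ j : ℝ) - (M.price x i.castSucc j : ℝ))

/-- The overall trading costs `Cₙ(Δ)`. -/
def tradingCosts (Δ : Strategy d n) (x : M.Omega) : ℝ :=
  ∑ j : Fin d, ∑ i : Fin (n + 1),
    (M.cTrans i j (M.price x i j) (M.position Δ x j i - M.prevPosition Δ x j i)
      + M.cSpread i j (M.price x i j) (M.position Δ x j i - M.prevPosition Δ x j i)
      + M.cShort i j (M.price x i j) (M.position Δ x j i))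

/-- The payoff `h_{c,Δ} = c + (Δ · S)ₙ - Cₙ(Δ)`. -/
def payoff (p : ℝ × Strategy d n) (x : M.Omega) : ℝ :=
  p.1 + M.grossProfit p.2 x - M.tradingCosts p.2 x

/-- The cost functions are continuous in their second argument. -/
def ContinuousCosts : Prop :=
  ∀ i j s, Continuous (M.cTrans i j s) ∧ Continuous (M.cSpread i j s) ∧
    Continuous (M.cShort i j s)

/-- The cost functions are bounded when the price ranges over its interval of possible values and
the second argument over a bounded set. This holds for instance when they are jointly
continuous. -/
def LocallyBoundedCosts : Prop :=
  ∀ i j, ∀ R : ℝ, ∃ C : ℝ, ∀ s ∈ Set.Icc (M.lo j) (M.hi j), ∀ x : ℝ, |x| ≤ R →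
    M.cTrans i j s x ≤ C ∧ M.cSpread i j s x ≤ C ∧ M.cShort i j s x ≤ C

/-- The pairs `(c, Δ)` that parametrize `ℋ_{B,L}`: `|c| ≤ B`, and each `Δᵢʲ` is `L`-Lipschitz for
the Euclidean norm and bounded by `B` on `Ωᵢ` (for `i = 0` this says `|Δ₀ʲ| ≤ B`). -/
def admissible (B L : ℝ) : Set (ℝ × Strategy d n) :=
  {p | |p.1| ≤ B ∧ ∀ (i : Fin n) (j : Fin d),
    (∀ y z, |p.2 i j y - p.2 i j z| ≤ L * ‖y - z‖) ∧
    ∀ y ∈ M.histories i, |p.2 i j y| ≤ B}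

/-- The conditional super-replication price `Γ_{B,L}(Φ, 𝒢)`, with `inf ∅ = +∞`. -/
def superRepPrice (Ps : Set (ProbabilityMeasure M.Omega)) (B L : ℝ) (Φ : M.Omega → ℝ)
    (𝒢 : MeasurableSpace M.Omega) : EReal :=
  ⨅ p ∈ {p | p ∈ M.admissible B L ∧
    ∀ P ∈ Ps, CondDominates 𝒢 P (M.payoff p) Φ},
    ((p.1 : ℝ) : EReal)

end Market

/-- The functions `φ_l ∘ A_{l-1} ∘ ⋯ ∘ φ_1 ∘ A_0 : E → ℝ^h` with `l ≥ 1` hidden layers, where the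
`A_i` are affine and each `φ_i` applies the activation function `φ` to every coordinate. -/
inductive IsHiddenLayer (φ : ℝ → ℝ) {E : Type} [AddCommGroup E] [Module ℝ E] :
    (h : ℕ) → (E → Fin h → ℝ) → Prop
  | first {h : ℕ} (A : E →ᵃ[ℝ] (Fin h → ℝ)) : IsHiddenLayer φ h (fun x k => φ (A x k))
  | next {h h' : ℕ} {f : E → Fin h → ℝ} (hf : IsHiddenLayer φ h f)
      (A : (Fin h → ℝ) →ᵃ[ℝ] (Fin h' → ℝ)) : IsHiddenLayer φ h' (fun x k => φ (A (f x) k))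

/-- The feed-forward neural networks from `E` to `ℝ^d` with activation function `φ`, any number
`l ≥ 1` of hidden layers and any hidden dimensions. -/
def neuralNetworks (φ : ℝ → ℝ) (E : Type) [AddCommGroup E] [Module ℝ E] (d : ℕ) :
    Set (E → Fin d → ℝ) :=
  {g | ∃ (h : ℕ) (f : E → Fin h → ℝ) (A : (Fin h → ℝ) →ᵃ[ℝ] (Fin d → ℝ)),
    IsHiddenLayer φ h f ∧ g = fun x => A (f x)}

/-- The activation function is `C¹` and not a polynomial, or it is the ReLU. -/
def IsAdmissibleActivation (φ : ℝ → ℝ) : Prop :=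
  (ContDiff ℝ 1 φ ∧ ¬ ∃ q : Polynomial ℝ, ∀ x, φ x = q.eval x) ∨ φ = fun x => max x 0

/-- A penalty function: continuous, zero on `(-∞, 0]` and positive on `(0, ∞)`. -/
def IsPenalty (β : ℝ → ℝ) : Prop :=
  Continuous β ∧ (∀ x ≤ 0, β x = 0) ∧ ∀ x > 0, 0 < β x

namespace Market

variable {d n : ℕ} (M : Market d n)

/-- The networks `𝔑_{i,B,L}` from `ℝ^{id}` to `ℝ^d` whose components are, on `Ωᵢ`, `L`-Lipschitz
and bounded by `B`. -/
def boundedNetworks (φ : ℝ → ℝ) (B L : ℝ) (i : ℕ) :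
    Set (EuclideanSpace ℝ (Fin i × Fin d) → Fin d → ℝ) :=
  {f | f ∈ neuralNetworks φ (EuclideanSpace ℝ (Fin i × Fin d)) d ∧ ∀ j : Fin d,
    (∀ y ∈ M.histories i, ∀ z ∈ M.histories i, |f y j - f z j| ≤ L * ‖y - z‖) ∧
    ∀ y ∈ M.histories i, |f y j| ≤ B}

/-- The pairs `(c, Δ)` that parametrize `ℋ^{NN}_{B,L}`: for `i = 1, …, n - 1` the positions `Δᵢ`
are given on `Ωᵢ`, the set of all possible price histories, by a network of `𝔑_{i,B,L}`. -/
def nnAdmissible (φ : ℝ → ℝ) (B L : ℝ) : Set (ℝ × Strategy d n) :=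
  {p | p ∈ M.admissible B L ∧ ∀ i : Fin n, 1 ≤ (i : ℕ) →
    ∃ f ∈ M.boundedNetworks φ B L i, ∀ y ∈ M.histories i, ∀ j, p.2 i j y = f y j}

/-- The penalized objective `c + k ∑_P ∫ β(E_P[Φ - h_{c,Δ} | 𝒢]) dP`. -/
def penalizedCost (Ps : Finset (ProbabilityMeasure M.Omega)) (β : ℝ → ℝ) (k : ℕ)
    (Φ : M.Omega → ℝ) (𝒢 : MeasurableSpace M.Omega) (p : ℝ × Strategy d n) : ℝ :=
  p.1 + k * ∑ P ∈ Ps, condPenalty β 𝒢 P (fun x => Φ x - M.payoff p x)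

/-- The penalized problem over neural network strategies, `Γ^{NN}_{B,L,k}(Φ, 𝒢)`. -/
def nnPenalizedPrice (Ps : Finset (ProbabilityMeasure M.Omega)) (β φ : ℝ → ℝ) (B L : ℝ) (k : ℕ)
    (Φ : M.Omega → ℝ) (𝒢 : MeasurableSpace M.Omega) : EReal :=
  ⨅ p ∈ M.nnAdmissible φ B L, ((M.penalizedCost Ps β k Φ 𝒢 p : ℝ) : EReal)

/-- A realization of the random intervals: `U i j = (a, b)` are the end points of the `j`-th side of
the `i`-th random box. -/
abbrev Draws (d : ℕ) : Type := ℕ → Fin d → ℝ × ℝ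

/-- The box `Aᵢ = (a₁, b₁] × ⋯ × (a_d, b_d]`, as a subset of the box of possible prices. -/
def randomBox (U : Draws d) (i : ℕ) : Set (PriceBox M.lo M.hi) :=
  {v | ∀ j, (v j : ℝ) ∈ Set.Ioc (U i j).1 (U i j).2}

/-- The partition `ℰᵢ`: it starts from the trivial one, and each step splits every member by the
next random box. (The boxes are numbered from `0`, so `ℰᵢ` uses the first `i` boxes.) -/
def partitions (U : Draws d) : ℕ → Set (Set (PriceBox M.lo M.hi))
  | 0 => {∅, Set.univ}
  | i + 1 => {F | ∃ E ∈ partitions U i,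
      F = E ∩ M.randomBox U i ∨ F = E ∩ (M.randomBox U i)ᶜ}

/-- The `σ`-algebra `ℱᵢ = {S_{tₙ}⁻¹(A) | A ∈ σ(ℰᵢ)}` on `Ω`. -/
abbrev partitionSigma (U : Draws d) (i : ℕ) : MeasurableSpace M.Omega :=
  MeasurableSpace.comap M.terminal (MeasurableSpace.generateFrom (M.partitions U i))

/-- The uniform distribution on `[K_j, K̄_j]`. -/
def uniformLaw (j : Fin d) : Measure ℝ :=
  ProbabilityTheory.cond volume (Set.Icc (M.lo j) (M.hi j))

instance (j : Fin d) : IsProbabilityMeasure (M.uniformLaw j) :=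
  cond_isProbabilityMeasure_of_finite (by simp [M.lo_lt_hi j]) (by simp)

/-- The law `P^U`: the left end points are independent and uniform on `[K_j, K̄_j]`, the right end
points are equal to `K̄_j`. -/
def drawLaw : Measure (Draws d) :=
  Measure.infinitePi fun _ : ℕ =>
    Measure.pi fun j : Fin d => (M.uniformLaw j).prod (Measure.dirac (M.hi j))

end Market

end

/-! Both limits are limits of infima of Gamma type (`tendsto_biInf_of_forall`): every strategy of
the limit problem needs competitors of nearly the same cost, and every sequence of cheap strategies
needs a limit that is at least as cheap. The latter is compactness. Strategies share a Lipschitz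
constant and bounds, so an Arzelà–Ascoli argument (`exists_subseq_convergesTo`) extracts a pointwise
convergent subsequence, and the payoffs, continuous in the positions and uniformly bounded, converge
with it.

As k → ∞, a cost at most `a` forces the total penalty below (a + B)/k. Hence limits have penalty
zero, which means conditional super-replication (`condPenalty_eq_zero_iff`). If no strategy
super-replicates, the same argument drives the infima to +∞.

As i → ∞, the σ-algebras and the class of strategies both have to be handled. Almost surely the left
end points of the boxes are dense, so the boxes generate all Borel sets away from the lower faces of
the price box; these faces are null if d ≥ 2 and a single point if d = 1. Lévy's upward theorem then
gives L¹ convergence of conditional expectations (`GenericDraws.tendsto_eLpNorm_condExp`), and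
`tendsto_condPenalty` passes it on to penalties of varying strategies.

Networks are dense in the L-Lipschitz functions bounded by B without loss in either constant
(`exists_neuralNetworks_near`). This rests on a lattice form of Stone–Weierstrass: affine functions
interpolate two values with slope at most L, and max and min do not increase Lipschitz constants. It
remains to realize a regularized absolute value of a network by networks, with an error small in the
Lipschitz norm. For the ReLU this is exact. For φ of class C¹ with nonconstant derivative, t and t²
are limits of one-layer networks, locally uniformly with their derivatives, so depth produces
products, polynomials and finally all C¹ functions of networks. A contraction by a factor 1 - τ
absorbs the remaining error. -/

/-! ### Lattice approximation of Lipschitz functions -/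

/-- A lattice of continuous functions that interpolates `f` at any two points of a compact set
approximates `f` uniformly there. -/
theorem exists_near_of_lattice {X : Type*} [TopologicalSpace X] {K : Set X} (hK : IsCompact K)
    (hne : K.Nonempty) {D : Set (X → ℝ)} (hcont : ∀ g ∈ D, ContinuousOn g K)
    (hsup : ∀ g ∈ D, ∀ h ∈ D, (fun x => max (g x) (h x)) ∈ D)
    (hinf : ∀ g ∈ D, ∀ h ∈ D, (fun x => min (g x) (h x)) ∈ D)
    {f : X → ℝ} (hf : ContinuousOn f K)
    (h2 : ∀ x ∈ K, ∀ y ∈ K, ∃ g ∈ D, g x = f x ∧ g y = f y) {ε : ℝ} (hε : 0 < ε) :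
    ∃ g ∈ D, ∀ x ∈ K, |g x - f x| < ε := by
  -- With x fixed, maxima over a finite subcover of K keep the value f x and push the function above
  -- f - ε everywhere. Minima over x then give the upper bound as well.
  have lower : ∀ x ∈ K, ∃ g ∈ D, g x = f x ∧ ∀ y ∈ K, f y - ε < g y := by
    intro x hx
    refine hK.induction_on (p := fun s => ∃ g ∈ D, g x = f x ∧ ∀ y ∈ s, f y - ε < g y)
      ?_ ?_ ?_ ?_
    · obtain ⟨g, hg, h, -⟩ := h2 x hx x hx
      exact ⟨g, hg, h, by simp⟩
    · rintro s t hst ⟨g, hg, h, h'⟩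
      exact ⟨g, hg, h, fun y hy => h' y (hst hy)⟩
    · rintro s t ⟨g, hg, h, h'⟩ ⟨g', hg', k, k'⟩
      refine ⟨_, hsup g hg g' hg', by simp [h, k], ?_⟩
      rintro y (hy | hy)
      · exact lt_max_of_lt_left (h' y hy)
      · exact lt_max_of_lt_right (k' y hy)
    · intro y hy
      obtain ⟨g, hg, h, h'⟩ := h2 x hx y hy
      have hc : ContinuousOn (fun z => g z - f z) K := (hcont g hg).sub hf
      have := (hc y hy).eventually (lt_mem_nhds (a := -ε) (by simp [h', hε]))
      exact ⟨_, this, g, hg, h, fun z hz => by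
        have : -ε < g z - f z := hz
        linarith⟩
  have upper : ∃ g ∈ D, (∀ y ∈ K, f y - ε < g y) ∧ ∀ y ∈ K, g y < f y + ε := by
    refine hK.induction_on
      (p := fun s => ∃ g ∈ D, (∀ y ∈ K, f y - ε < g y) ∧ ∀ y ∈ s, g y < f y + ε) ?_ ?_ ?_ ?_
    · obtain ⟨x, hx⟩ := hne
      obtain ⟨g, hg, -, h⟩ := lower x hx
      exact ⟨g, hg, h, by simp⟩
    · rintro s t hst ⟨g, hg, h, h'⟩
      exact ⟨g, hg, h, fun y hy => h' y (hst hy)⟩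
    · rintro s t ⟨g, hg, h, h'⟩ ⟨g', hg', k, k'⟩
      refine ⟨_, hinf g hg g' hg', fun y hy => lt_min (h y hy) (k y hy), ?_⟩
      rintro y (hy | hy)
      · exact min_lt_of_left_lt (h' y hy)
      · exact min_lt_of_right_lt (k' y hy)
    · intro y hy
      obtain ⟨g, hg, h, h'⟩ := lower y hy
      have hc : ContinuousOn (fun z => g z - f z) K := (hcont g hg).sub hf
      have := (hc y hy).eventually (gt_mem_nhds (show g y - f y < ε by linarith))
      exact ⟨_, this, g, hg, h', fun z hz => by
        have : g z - f z < ε := hz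
        linarith⟩
  obtain ⟨g, hg, h, h'⟩ := upper
  exact ⟨g, hg, fun x hx => abs_lt.2 ⟨by linarith [h x hx], by linarith [h' x hx]⟩⟩

/-- `f` is `C`-Lipschitz on `K`. -/
def LipOn {E : Type*} [SeminormedAddCommGroup E] (K : Set E) (C : ℝ) (f : E → ℝ) : Prop :=
  ∀ x ∈ K, ∀ y ∈ K, |f x - f y| ≤ C * ‖x - y‖

theorem LipOn.continuousOn {E : Type*} [SeminormedAddCommGroup E] {K : Set E} {C : ℝ} {f : E → ℝ}
    (h : LipOn K C f) : ContinuousOn f K := by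
  have : LipschitzOnWith C.toNNReal f K := by
    refine LipschitzOnWith.of_dist_le_mul fun x hx y hy => ?_
    rw [Real.dist_eq, dist_eq_norm]
    exact (h x hx y hy).trans
      (mul_le_mul_of_nonneg_right (Real.le_coe_toNNReal C) (norm_nonneg _))
  exact this.continuousOn

theorem LipOn.of_near {E : Type*} [SeminormedAddCommGroup E] {K : Set E} {C : ℝ} {f : E → ℝ}
    (h : ∀ ε > 0, ∃ g, LipOn K C g ∧ ∀ x ∈ K, |g x - f x| ≤ ε) : LipOn K C f := by
  intro x hx y hy
  refine le_of_forall_pos_le_add fun ε hε => ?_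
  obtain ⟨g, hg, hgf⟩ := h (ε / 2) (by positivity)
  have h1 := abs_le.1 (hg x hx y hy)
  have h2 := abs_le.1 (hgf x hx)
  have h3 := abs_le.1 (hgf y hy)
  exact abs_le.2 ⟨by linarith [h1.1, h2.1, h3.2], by linarith [h1.2, h2.2, h3.1]⟩

/-- If a and b are the increments of u and v, the increment of the combination lies between (a + b -
|a - b|)/2 = min a b and (a + b + |a - b|)/2 = max a b, because θ is 1-Lipschitz. So smoothing the
maximum or minimum costs nothing in the Lipschitz constant. -/
theorem LipOn.smoothMax {E : Type*} [SeminormedAddCommGroup E] {K : Set E} {C σ : ℝ}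
    {u v : E → ℝ} {θ : ℝ → ℝ} (hθ : ∀ s t, |θ s - θ t| ≤ |s - t|) (hσ : |σ| = 1)
    (hu : LipOn K C u) (hv : LipOn K C v) :
    LipOn K C (fun x => (1 / 2 : ℝ) * (u x + v x + σ * θ (u x - v x))) := by
  intro x hx y hy
  have h1 := abs_le.1 (hu x hx y hy)
  have h2 := abs_le.1 (hv x hx y hy)
  have h3 : |σ * θ (u x - v x) - σ * θ (u y - v y)| ≤ |(u x - v x) - (u y - v y)| := by
    rw [← mul_sub, abs_mul, hσ, one_mul]
    exact hθ _ _
  have h4 := abs_le.1 h3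
  rw [abs_le]
  rcases abs_cases ((u x - v x) - (u y - v y)) with ⟨h, -⟩ | ⟨h, -⟩ <;> rw [h] at h4 <;>
    constructor <;> linarith [h1.1, h1.2, h2.1, h2.2, h4.1, h4.2]

/-- Lipschitz functions on a compact set are approximated by members, with the same Lipschitz
constant, of a linear space which contains the affine functions and is stable under regularized
absolute values. -/
theorem exists_near_lipOn_of_smoothAbs {E : Type*} [NormedAddCommGroup E] [InnerProductSpace ℝ E]
    {K : Set E} (hK : IsCompact K) (hne : K.Nonempty) (A : Submodule ℝ (E → ℝ))
    (haff : ∀ (l : E →L[ℝ] ℝ) (c : ℝ), (fun x => l x + c) ∈ A)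
    (habs : ∀ η > 0, ∃ θ : ℝ → ℝ, (∀ s t, |θ s - θ t| ≤ |s - t|) ∧ (∀ t, abs (θ t - |t|) ≤ η) ∧
      ∀ g ∈ A, (fun x => θ (g x)) ∈ A)
    {L : ℝ} {f : E → ℝ} (hf : LipOn K L f) {ε : ℝ} (hε : 0 < ε) :
    ∃ g ∈ A, LipOn K L g ∧ ∀ x ∈ K, |g x - f x| ≤ ε := by
  -- The lattice is the uniform closure of the L-Lipschitz members of A: since θ only approximates
  -- the absolute value, maxima and minima need not lie in A itself.
  set D : Set (E → ℝ) := {g | ∀ ε > 0, ∃ u ∈ A, LipOn K L u ∧ ∀ x ∈ K, |u x - g x| ≤ ε} with hD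
  have hlip : ∀ g ∈ D, LipOn K L g := fun g hg => LipOn.of_near fun ε hε => by
    obtain ⟨u, -, h⟩ := hg ε hε
    exact ⟨u, h⟩
  have key : ∀ σ : ℝ, |σ| = 1 → ∀ g ∈ D, ∀ h ∈ D,
      (fun x => (1 / 2 : ℝ) * (g x + h x + σ * |g x - h x|)) ∈ D := by
    intro σ hσ g hg h hh ε hε
    obtain ⟨u, huA, hu, hug⟩ := hg (ε / 4) (by positivity)
    obtain ⟨v, hvA, hv, hvh⟩ := hh (ε / 4) (by positivity)
    obtain ⟨θ, hθ, hθa, hθA⟩ := habs (ε / 2) (by positivity)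
    refine ⟨_, ?_, LipOn.smoothMax hθ hσ hu hv, fun x hx => ?_⟩
    · exact A.smul_mem (1 / 2) (A.add_mem (A.add_mem huA hvA)
        (A.smul_mem σ (hθA _ (A.sub_mem huA hvA))))
    · have h1 := abs_le.1 (hug x hx)
      have h2 := abs_le.1 (hvh x hx)
      have h3 : abs (σ * θ (u x - v x) - σ * |g x - h x|) ≤ ε / 2 + ε / 2 := by
        rw [← mul_sub, abs_mul, hσ, one_mul]
        have h4 := abs_le.1 (hθa (u x - v x))
        have h5 : abs (|u x - v x| - |g x - h x|) ≤ ε / 2 := by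
          refine (abs_abs_sub_abs_le _ _).trans (abs_le.2 ⟨?_, ?_⟩) <;>
            linarith [h1.1, h1.2, h2.1, h2.2]
        have h6 := abs_le.1 h5
        exact abs_le.2 ⟨by linarith [h4.1, h6.1], by linarith [h4.2, h6.2]⟩
      have h4 := abs_le.1 h3
      exact abs_le.2 ⟨by linarith [h1.1, h2.1, h4.1], by linarith [h1.2, h2.2, h4.2]⟩
  have two : ∀ x ∈ K, ∀ y ∈ K, ∃ g ∈ D, g x = f x ∧ g y = f y := by
    intro x hx y hy
    -- The affine interpolant varies only in the direction x - y; by Cauchy–Schwarz its slope is |f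
    -- x - f y| / ‖x - y‖ ≤ L. For x = y the division by zero makes it constant.
    set l : E →L[ℝ] ℝ := ((f x - f y) / ‖x - y‖ ^ 2) • innerSL ℝ (x - y) with hl
    have hlv : ∀ z, l z = (f x - f y) / ‖x - y‖ ^ 2 * inner ℝ (x - y) z := fun z => by
      simp only [hl, smul_apply, innerSL_apply_apply, smul_eq_mul]
    refine ⟨fun z => l z + (f y - l y), ?_, ?_, by ring⟩
    · intro ε hε
      refine ⟨_, haff l (f y - l y), ?_, fun z _ => by simpa using hε.le⟩
      intro z hz w hw
      have : l z + (f y - l y) - (l w + (f y - l y)) = l (z - w) := by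
        rw [map_sub]; ring
      rw [this, hlv, abs_mul, abs_div, abs_of_nonneg (sq_nonneg ‖x - y‖)]
      by_cases hxy : ‖x - y‖ = 0
      · have := hf z hz w hw
        simp [hxy]
        exact (abs_nonneg _).trans this
      · have hpos : 0 < ‖x - y‖ := lt_of_le_of_ne (norm_nonneg _) (Ne.symm hxy)
        calc |f x - f y| / ‖x - y‖ ^ 2 * |inner ℝ (x - y) (z - w)|
            ≤ (L * ‖x - y‖) / ‖x - y‖ ^ 2 * (‖x - y‖ * ‖z - w‖) := by
              have := hf x hx y hy
              have h' := abs_real_inner_le_norm (x - y) (z - w)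
              have := (abs_nonneg _).trans this
              gcongr
          _ = L * ‖z - w‖ := by field_simp
    · have : l x - l y = f x - f y := by
        rw [← map_sub, hlv, real_inner_self_eq_norm_sq]
        by_cases hxy : ‖x - y‖ = 0
        · have := sub_eq_zero.1 (norm_eq_zero.1 hxy)
          simp [this]
        · field_simp
      show l x + (f y - l y) = f x
      linarith
  obtain ⟨g, hg, hgf⟩ := exists_near_of_lattice hK hne (D := D)
    (fun g hg => (hlip g hg).continuousOn)
    (fun g hg h hh => by
      convert key 1 (by simp) g hg h hh using 2 with x
      rcases le_total (g x) (h x) with hx | hx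
      · rw [max_eq_right hx, abs_of_nonpos (by linarith)]; ring
      · rw [max_eq_left hx, abs_of_nonneg (by linarith)]; ring)
    (fun g hg h hh => by
      convert key (-1) (by simp) g hg h hh using 2 with x
      rcases le_total (g x) (h x) with hx | hx
      · rw [min_eq_left hx, abs_of_nonpos (by linarith)]; ring
      · rw [min_eq_right hx, abs_of_nonneg (by linarith)]; ring)
    hf.continuousOn two (half_pos hε)
  obtain ⟨u, huA, hu, hug⟩ := hg (ε / 2) (half_pos hε)
  refine ⟨u, huA, hu, fun x hx => ?_⟩
  have h1 := abs_le.1 (hug x hx)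
  have h2 := abs_lt.1 (hgf x hx)
  exact abs_le.2 ⟨by linarith [h1.1, h2.1], by linarith [h1.2, h2.2]⟩

/-! ### Scalar networks and their assembly into feed-forward networks -/

section Networks

variable {E : Type} [NormedAddCommGroup E] [NormedSpace ℝ E]

/-- The continuous affine functions on `E`. -/
def affineFunctions (E : Type) [NormedAddCommGroup E] [NormedSpace ℝ E] :
    Submodule ℝ (E → ℝ) where
  carrier := {u | ∃ (l : E →L[ℝ] ℝ) (c : ℝ), u = fun x => l x + c}
  add_mem' := by
    rintro _ _ ⟨l, c, rfl⟩ ⟨l', c', rfl⟩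
    exact ⟨l + l', c + c', by ext x; simp; ring⟩
  zero_mem' := ⟨0, 0, by ext x; simp⟩
  smul_mem' := by
    rintro a _ ⟨l, c, rfl⟩
    exact ⟨a • l, a * c, by ext x; simp; ring⟩

/-- The scalar networks on `E` with `l` hidden layers. -/
def scalarNetworks (φ : ℝ → ℝ) (E : Type) [NormedAddCommGroup E] [NormedSpace ℝ E] :
    ℕ → Submodule ℝ (E → ℝ)
  | 0 => affineFunctions E
  | l + 1 => Submodule.span ℝ
      ({g | ∃ u ∈ scalarNetworks φ E l, g = fun x => φ (u x)} ∪ {fun _ => 1})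

theorem comp_mem_scalarNetworks {φ : ℝ → ℝ} {l : ℕ} {u : E → ℝ} (hu : u ∈ scalarNetworks φ E l) :
    (fun x => φ (u x)) ∈ scalarNetworks φ E (l + 1) :=
  Submodule.subset_span (Or.inl ⟨u, hu, rfl⟩)

theorem const_mem_scalarNetworks {φ : ℝ → ℝ} {l : ℕ} (c : ℝ) :
    (fun _ => c) ∈ scalarNetworks φ E l := by
  cases l with
  | zero => exact ⟨0, c, by simp⟩
  | succ l =>
    have : (fun _ : E => (1 : ℝ)) ∈ scalarNetworks φ E (l + 1) :=
      Submodule.subset_span (Or.inr rfl)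
    simpa [Pi.smul_def] using Submodule.smul_mem _ c this

theorem exists_sum_of_mem_scalarNetworks {φ : ℝ → ℝ} {l : ℕ} {u : E → ℝ}
    (hu : u ∈ scalarNetworks φ E (l + 1)) :
    ∃ (ι : Type) (_ : Fintype ι) (v : ι → E → ℝ) (w : ι → ℝ) (c : ℝ),
      (∀ i, v i ∈ scalarNetworks φ E l) ∧ ∀ x, u x = ∑ i, w i * φ (v i x) + c := by
  induction hu using Submodule.span_induction with
  | mem g hg =>
    rcases hg with ⟨v, hv, rfl⟩ | rfl
    · exact ⟨Unit, inferInstance, fun _ => v, fun _ => 1, 0, fun _ => hv, by simp⟩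
    · exact ⟨Empty, inferInstance, Empty.elim, Empty.elim, 1, fun i => i.elim, by simp⟩
  | zero => exact ⟨Empty, inferInstance, Empty.elim, Empty.elim, 0, fun i => i.elim, by simp⟩
  | add g h _ _ hg hh =>
    obtain ⟨ι, _, v, w, c, hv, e⟩ := hg
    obtain ⟨ι', _, v', w', c', hv', e'⟩ := hh
    refine ⟨ι ⊕ ι', inferInstance, Sum.elim v v', Sum.elim w w', c + c', ?_, fun x => ?_⟩
    · rintro (i | i)
      exacts [hv i, hv' i]
    · simp [e, e']; ring
  | smul a g _ hg =>
    obtain ⟨ι, _, v, w, c, hv, e⟩ := hg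
    refine ⟨ι, inferInstance, v, fun i => a * w i, a * c, hv, fun x => ?_⟩
    simp [e, mul_add, Finset.mul_sum, mul_assoc]

/-- The coordinates share one hidden layer: its neurons are the disjoint union of the neurons of the
individual coordinates, and the weight matrix vanishes outside the block of each coordinate. This
requires all coordinates to have the same depth. -/
theorem exists_affine_of_mem_scalarNetworks {φ : ℝ → ℝ} {l h : ℕ} {u : Fin h → E → ℝ}
    (hu : ∀ k, u k ∈ scalarNetworks φ E (l + 1)) :
    ∃ (m : ℕ) (v : Fin m → E → ℝ) (A : (Fin m → ℝ) →ᵃ[ℝ] (Fin h → ℝ)),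
      (∀ i, v i ∈ scalarNetworks φ E l) ∧ ∀ x, (fun k => u k x) = A fun i => φ (v i x) := by
  choose ι hι v w c hv e using fun k => exists_sum_of_mem_scalarNetworks (hu k)
  classical
  let eq : (Σ k, ι k) ≃ Fin (Fintype.card (Σ k, ι k)) := Fintype.equivFin _
  let W : Matrix (Fin h) (Fin (Fintype.card (Σ k, ι k))) ℝ := Matrix.of fun k i =>
    if (eq.symm i).1 = k then w _ (eq.symm i).2 else 0
  refine ⟨_, fun i => v _ (eq.symm i).2,
    (Matrix.toLin' W).toAffineMap + AffineMap.const ℝ _ c, fun i => hv _ _, fun x => ?_⟩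
  ext k
  simp only [AffineMap.coe_add, LinearMap.coe_toAffineMap, AffineMap.coe_const, Pi.add_apply,
    Function.const_apply, Matrix.toLin'_apply, Matrix.mulVec, dotProduct, W, Matrix.of_apply]
  rw [e, ← eq.sum_comp]
  have hp : ∀ p : Σ k, ι k, w (eq.symm (eq p)).1 (eq.symm (eq p)).2 *
      φ (v (eq.symm (eq p)).1 (eq.symm (eq p)).2 x) = w p.1 p.2 * φ (v p.1 p.2 x) := fun p => by
    rw [eq.symm_apply_apply]
  rw [Fintype.sum_sigma]
  congr 1
  rw [Finset.sum_eq_single k]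
  · exact Finset.sum_congr rfl fun i _ => by
      rw [← hp ⟨k, i⟩]
      simp
  · intro b _ hb
    simp [hb]
  · simp

theorem isHiddenLayer_of_mem_scalarNetworks {φ : ℝ → ℝ} {l h : ℕ} {u : Fin h → E → ℝ}
    (hu : ∀ k, u k ∈ scalarNetworks φ E l) : IsHiddenLayer φ h fun x k => φ (u k x) := by
  induction l generalizing h with
  | zero =>
    choose f c e using hu
    convert IsHiddenLayer.first (φ := φ)
      ((LinearMap.pi fun k => (f k : E →ₗ[ℝ] ℝ)).toAffineMap + AffineMap.const ℝ _ c) using 4 with x k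
    simp [e k]
  | succ l ih =>
    obtain ⟨m, v, A, hv, e⟩ := exists_affine_of_mem_scalarNetworks hu
    convert IsHiddenLayer.next (ih hv) A using 4 with x k
    exact congrFun (e x) k

theorem mem_neuralNetworks_of_mem_scalarNetworks {φ : ℝ → ℝ} {l d : ℕ} {u : Fin d → E → ℝ}
    (hu : ∀ k, u k ∈ scalarNetworks φ E (l + 1)) :
    (fun x k => u k x) ∈ neuralNetworks φ E d := by
  obtain ⟨m, v, A, hv, e⟩ := exists_affine_of_mem_scalarNetworks hu
  exact ⟨m, _, A, isHiddenLayer_of_mem_scalarNetworks hv, funext e⟩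

end Networks

/-! ### Calculus of smallness in the Lipschitz norm -/

/-- `f` is bounded by `ε` and `ε`-Lipschitz on `K`. -/
def SmallOn {E : Type*} [SeminormedAddCommGroup E] (K : Set E) (ε : ℝ) (f : E → ℝ) : Prop :=
  (∀ x ∈ K, |f x| ≤ ε) ∧ LipOn K ε f

namespace SmallOn

variable {E : Type*} [SeminormedAddCommGroup E] {K : Set E} {ε δ : ℝ} {f g : E → ℝ}

theorem mono (h : SmallOn K ε f) (hle : ε ≤ δ) : SmallOn K δ f :=
  ⟨fun x hx => (h.1 x hx).trans hle, fun x hx y hy =>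
    (h.2 x hx y hy).trans (mul_le_mul_of_nonneg_right hle (norm_nonneg _))⟩

theorem zero (hε : 0 ≤ ε) : SmallOn K ε (fun _ => 0) :=
  ⟨fun x _ => by simpa using hε, fun x _ y _ => by simpa using mul_nonneg hε (norm_nonneg _)⟩

theorem const (c : ℝ) : SmallOn K |c| (fun _ => c) :=
  ⟨fun x _ => le_rfl, fun x _ y _ => by simpa using mul_nonneg (abs_nonneg c) (norm_nonneg _)⟩

theorem add (hf : SmallOn K ε f) (hg : SmallOn K δ g) :
    SmallOn K (ε + δ) (fun x => f x + g x) := by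
  refine ⟨fun x hx => (abs_add_le _ _).trans (add_le_add (hf.1 x hx) (hg.1 x hx)),
    fun x hx y hy => ?_⟩
  calc |f x + g x - (f y + g y)| = |(f x - f y) + (g x - g y)| := by ring_nf
    _ ≤ _ := (abs_add_le _ _).trans (add_le_add (hf.2 x hx y hy) (hg.2 x hx y hy))
    _ = _ := by ring

theorem smul (c : ℝ) (hf : SmallOn K ε f) : SmallOn K (|c| * ε) (fun x => c * f x) := by
  refine ⟨fun x hx => ?_, fun x hx y hy => ?_⟩
  · rw [abs_mul]
    exact mul_le_mul_of_nonneg_left (hf.1 x hx) (abs_nonneg c)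
  · rw [← mul_sub, abs_mul, mul_assoc]
    exact mul_le_mul_of_nonneg_left (hf.2 x hx y hy) (abs_nonneg c)

theorem mul (hf : SmallOn K ε f) (hg : SmallOn K δ g) :
    SmallOn K (2 * (ε * δ)) (fun x => f x * g x) := by
  have nn : ∀ x ∈ K, 0 ≤ ε * δ := fun x hx =>
    mul_nonneg ((abs_nonneg _).trans (hf.1 x hx)) ((abs_nonneg _).trans (hg.1 x hx))
  have bd : ∀ x ∈ K, |f x * g x| ≤ ε * δ := fun x hx => by
    rw [abs_mul]
    exact mul_le_mul (hf.1 x hx) (hg.1 x hx) (abs_nonneg _) ((abs_nonneg _).trans (hf.1 x hx))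
  refine ⟨fun x hx => (bd x hx).trans (by linarith [nn x hx]), fun x hx y hy => ?_⟩
  calc |f x * g x - f y * g y| = |f x * (g x - g y) + (f x - f y) * g y| := by ring_nf
    _ ≤ |f x| * |g x - g y| + |f x - f y| * |g y| := by
      rw [← abs_mul, ← abs_mul]; exact abs_add_le _ _
    _ ≤ ε * (δ * ‖x - y‖) + (ε * ‖x - y‖) * δ := by
      have h1 := hf.1 x hx
      have h2 := hg.2 x hx y hy
      have h3 := hf.2 x hx y hy
      have h4 := hg.1 y hy
      have h5 := (abs_nonneg _).trans h1
      have h6 := (abs_nonneg _).trans h3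
      gcongr
    _ = _ := by ring

/-- The sup bound is δ and the Lipschitz constant is δ * C; the factor `max 1 C` covers both. -/
theorem comp {θ : ℝ → ℝ} {C : ℝ} (hθ : SmallOn (Set.Icc (-C) C) δ θ) (hf : SmallOn K C f) :
    SmallOn K (δ * max 1 C) (fun x => θ (f x)) := by
  have mem : ∀ x ∈ K, f x ∈ Set.Icc (-C) C := fun x hx => abs_le.1 (hf.1 x hx)
  have hδ : ∀ x ∈ K, 0 ≤ δ := fun x hx => (abs_nonneg _).trans (hθ.1 _ (mem x hx))
  refine ⟨fun x hx => (hθ.1 _ (mem x hx)).trans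
    (le_mul_of_one_le_right (hδ x hx) (le_max_left _ _)), fun x hx y hy => ?_⟩
  calc |θ (f x) - θ (f y)| ≤ δ * |f x - f y| := hθ.2 _ (mem x hx) _ (mem y hy)
    _ ≤ δ * (max 1 C * ‖x - y‖) := by
      refine mul_le_mul_of_nonneg_left ((hf.2 x hx y hy).trans ?_) (hδ x hx)
      exact mul_le_mul_of_nonneg_right (le_max_right _ _) (norm_nonneg _)
    _ = _ := by ring

/-- By the mean value inequality δ is a Lipschitz constant, and θ 0 = 0 turns it into the sup bound
δ * R. Approximation in the Lipschitz norm is thereby reduced to uniform approximation of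
derivatives. -/
theorem of_hasDerivAt {θ θ' : ℝ → ℝ} {R : ℝ} (h : ∀ t, HasDerivAt θ (θ' t) t)
    (hb : ∀ t, |t| ≤ R → |θ' t| ≤ δ) (h0 : θ 0 = 0) :
    SmallOn (Set.Icc (-R) R) (δ * max 1 R) θ := by
  have lip : ∀ s ∈ Set.Icc (-R) R, ∀ t ∈ Set.Icc (-R) R, |θ s - θ t| ≤ δ * ‖s - t‖ :=
    fun s hs t ht => (convex_Icc (-R) R).norm_image_sub_le_of_norm_hasDerivWithin_le
      (fun x _ => (h x).hasDerivWithinAt) (fun x hx => hb x (abs_le.2 hx)) ht hs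
  have hδ : ∀ s ∈ Set.Icc (-R) R, 0 ≤ δ := fun s hs => (abs_nonneg _).trans (hb s (abs_le.2 hs))
  refine ⟨fun s hs => ?_, fun s hs t ht => (lip s hs t ht).trans ?_⟩
  · have hR : 0 ≤ R := (abs_nonneg s).trans (abs_le.2 hs)
    have := lip s hs 0 ⟨by linarith, hR⟩
    rw [h0, sub_zero, sub_zero] at this
    refine this.trans (mul_le_mul_of_nonneg_left ?_ (hδ s hs))
    exact (abs_le.2 hs).trans (le_max_right _ _)
  · exact mul_le_mul_of_nonneg_right
      (le_mul_of_one_le_right (hδ s hs) (le_max_left _ _)) (norm_nonneg _)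

end SmallOn

/-! ### Derivatives of one-layer networks on the line -/

section OneLayer

/-- The networks on `ℝ` with one hidden layer. -/
def oneLayer (φ : ℝ → ℝ) : Submodule ℝ (ℝ → ℝ) :=
  Submodule.span ℝ ({s | ∃ a b : ℝ, s = fun t => φ (a * t + b)} ∪ {fun _ => 1})

theorem const_mem_oneLayer {φ : ℝ → ℝ} (c : ℝ) : (fun _ => c) ∈ oneLayer φ := by
  have : (fun _ : ℝ => (1 : ℝ)) ∈ oneLayer φ := Submodule.subset_span (Or.inr rfl)
  simpa [Pi.smul_def] using Submodule.smul_mem _ c this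

theorem affine_comp_mem_oneLayer {φ s : ℝ → ℝ} (hs : s ∈ oneLayer φ) (a b : ℝ) :
    (fun t => s (a * t + b)) ∈ oneLayer φ := by
  induction hs using Submodule.span_induction with
  | mem g hg =>
    rcases hg with ⟨a', b', rfl⟩ | rfl
    · exact Submodule.subset_span (Or.inl ⟨a' * a, a' * b + b', by ext t; ring_nf⟩)
    · exact const_mem_oneLayer 1
  | zero => exact const_mem_oneLayer 0
  | add g h _ _ hg hh => exact Submodule.add_mem _ hg hh
  | smul c g _ hg => exact Submodule.smul_mem _ c hg

/-- The locally uniform limits of derivatives of networks on `ℝ` with one hidden layer. -/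
def derivClosure (φ : ℝ → ℝ) : Submodule ℝ (ℝ → ℝ) where
  carrier := {ψ | ∀ R > 0, ∀ δ > 0, ∃ s ∈ oneLayer φ, ∃ s' : ℝ → ℝ,
    (∀ t, HasDerivAt s (s' t) t) ∧ ∀ t, |t| ≤ R → |s' t - ψ t| ≤ δ}
  add_mem' := by
    intro ψ ψ' h h' R hR δ hδ
    obtain ⟨s, hs, s', hd, hb⟩ := h R hR (δ / 2) (half_pos hδ)
    obtain ⟨r, hr, r', hd', hb'⟩ := h' R hR (δ / 2) (half_pos hδ)
    refine ⟨_, Submodule.add_mem _ hs hr, _, fun t => (hd t).add (hd' t), fun t ht => ?_⟩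
    have h1 := abs_le.1 (hb t ht)
    have h2 := abs_le.1 (hb' t ht)
    simp only [Pi.add_apply]
    exact abs_le.2 ⟨by linarith [h1.1, h2.1], by linarith [h1.2, h2.2]⟩
  zero_mem' := fun R hR δ hδ =>
    ⟨_, const_mem_oneLayer 0, fun _ => 0, fun t => hasDerivAt_const _ _, fun t _ => by
      simpa using hδ.le⟩
  smul_mem' := by
    intro c ψ h R hR δ hδ
    obtain ⟨s, hs, s', hd, hb⟩ := h R hR (δ / (|c| + 1)) (by positivity)
    refine ⟨_, Submodule.smul_mem _ c hs, _, fun t => (hd t).const_smul c, fun t ht => ?_⟩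
    simp only [Pi.smul_apply, smul_eq_mul]
    rw [← mul_sub, abs_mul]
    calc |c| * |s' t - ψ t| ≤ (|c| + 1) * (δ / (|c| + 1)) := by
          have := hb t ht
          gcongr
          linarith
      _ = δ := by field_simp

variable {φ χ : ℝ → ℝ}

theorem derivClosure_of_near {ψ : ℝ → ℝ} (h : ∀ R > 0, ∀ δ > 0, ∃ ψ' ∈ derivClosure φ,
    ∀ t, |t| ≤ R → |ψ' t - ψ t| ≤ δ) : ψ ∈ derivClosure φ := by
  intro R hR δ hδ
  obtain ⟨ψ', hψ', hb⟩ := h R hR (δ / 2) (half_pos hδ)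
  obtain ⟨s, hs, s', hd, hb'⟩ := hψ' R hR (δ / 2) (half_pos hδ)
  refine ⟨s, hs, s', hd, fun t ht => ?_⟩
  have h1 := abs_le.1 (hb t ht)
  have h2 := abs_le.1 (hb' t ht)
  exact abs_le.2 ⟨by linarith [h1.1, h2.1], by linarith [h1.2, h2.2]⟩

/-- The chain rule contributes a factor a, which a⁻¹ in front of the network cancels. -/
theorem affine_comp_mem_derivClosure {ψ : ℝ → ℝ} (h : ψ ∈ derivClosure φ) {a : ℝ} (ha : a ≠ 0)
    (b : ℝ) : (fun t => ψ (a * t + b)) ∈ derivClosure φ := by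
  intro R hR δ hδ
  obtain ⟨s, hs, s', hd, hb⟩ := h (|a| * R + |b|) (by positivity) δ hδ
  refine ⟨_, Submodule.smul_mem _ a⁻¹ (affine_comp_mem_oneLayer hs a b),
    fun t => s' (a * t + b), fun t => ?_, fun t ht => hb _ ?_⟩
  · have h1 : HasDerivAt (fun t : ℝ => a * t + b) a t := by
      simpa using ((hasDerivAt_id t).const_mul a).add_const b
    have h2 := ((hd (a * t + b)).comp t h1).const_smul a⁻¹
    have h3 : a⁻¹ • (s' (a * t + b) * a) = s' (a * t + b) := by
      rw [smul_eq_mul]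
      field_simp
    rw [h3] at h2
    exact h2
  · refine (abs_add_le _ _).trans (add_le_add ?_ le_rfl)
    rw [abs_mul]
    exact mul_le_mul_of_nonneg_left ht (abs_nonneg a)

theorem deriv_mem_derivClosure (hφ : ∀ t, HasDerivAt φ (χ t) t) : χ ∈ derivClosure φ :=
  fun R hR δ hδ => ⟨φ, Submodule.subset_span (Or.inl ⟨1, 0, by simp⟩), χ, hφ, fun t _ => by
    simpa using hδ.le⟩

/-- Zooming in at b makes the continuous function χ / χ b look constant on any bounded interval. -/
theorem one_mem_derivClosure (hφ : ∀ t, HasDerivAt φ (χ t) t) (hχ : Continuous χ) {b : ℝ}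
    (hb : χ b ≠ 0) : (fun _ => 1) ∈ derivClosure φ := by
  refine derivClosure_of_near fun R hR δ hδ => ?_
  have hc : ContinuousAt (fun y => (χ b)⁻¹ * χ y) b := (continuous_const.mul hχ).continuousAt
  obtain ⟨r, hr, h⟩ := Metric.continuousAt_iff.1 hc δ hδ
  -- This scale sends |t| ≤ R strictly inside the r-neighbourhood of b; the +1 gives the strict
  -- inequality.
  have ha : r / (R + 1) ≠ 0 := by positivity
  refine ⟨_, Submodule.smul_mem _ (χ b)⁻¹
    (affine_comp_mem_derivClosure (deriv_mem_derivClosure hφ) ha b), fun t ht => ?_⟩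
  have h1 : dist (r / (R + 1) * t + b) b < r := by
    rw [Real.dist_eq, add_sub_cancel_right, abs_mul, abs_of_pos (by positivity)]
    calc r / (R + 1) * |t| ≤ r / (R + 1) * R := by gcongr
      _ < r / (R + 1) * (R + 1) := by gcongr; linarith
      _ = r := by field_simp
  have h2 := h h1
  rw [Real.dist_eq, inv_mul_cancel₀ hb] at h2
  exact h2.le

/-- Zooming in at b, the first-order expansion shows that (ψ(at + b) - ψ b)/(aκ) tends to t locally
uniformly as a → 0. -/
theorem id_mem_derivClosure_of_hasDerivAt {ψ : ℝ → ℝ} (h1 : (fun _ => 1) ∈ derivClosure φ)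
    (hψ : ψ ∈ derivClosure φ) {b κ : ℝ} (hκ : κ ≠ 0) (hd : HasDerivAt ψ κ b) :
    (fun t => t) ∈ derivClosure φ := by
  refine derivClosure_of_near fun R hR δ hδ => ?_
  have hlo := hasDerivAt_iff_isLittleO.1 hd
  have := hlo.def (c := |κ| * δ / (R + 1)) (by positivity)
  obtain ⟨r, hr, h⟩ := Metric.eventually_nhds_iff.1 this
  set a := r / (R + 1) with ha
  have hapos : 0 < a := by positivity
  refine ⟨_, Submodule.smul_mem _ (a * κ)⁻¹ (Submodule.sub_mem _
    (affine_comp_mem_derivClosure hψ hapos.ne' b) (Submodule.smul_mem _ (ψ b) h1)), fun t ht => ?_⟩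
  have hd : dist (a * t + b) b < r := by
    rw [Real.dist_eq, add_sub_cancel_right, abs_mul, abs_of_pos hapos]
    calc a * |t| ≤ r / (R + 1) * R := by gcongr
      _ < r / (R + 1) * (R + 1) := by gcongr; linarith
      _ = r := by field_simp
  have h2 := h hd
  simp only [Real.norm_eq_abs, smul_eq_mul, add_sub_cancel_right, abs_mul, abs_of_pos hapos] at h2
  simp only [Pi.smul_apply, Pi.sub_apply, smul_eq_mul, mul_one]
  have h3 : (a * κ)⁻¹ * (ψ (a * t + b) - ψ b) - t
      = (a * κ)⁻¹ * (ψ (a * t + b) - ψ b - a * t * κ) := by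
    field_simp
  rw [h3, abs_mul, abs_inv, abs_mul, abs_of_pos hapos]
  have hκ' : 0 < |κ| := abs_pos.2 hκ
  calc (a * |κ|)⁻¹ * |ψ (a * t + b) - ψ b - a * t * κ|
      ≤ (a * |κ|)⁻¹ * (|κ| * δ / (R + 1) * (a * R)) := by
        refine mul_le_mul_of_nonneg_left (h2.trans ?_) (by positivity)
        have : |κ * δ / (R + 1)| = |κ| * δ / (R + 1) := by
          rw [abs_div, abs_mul, abs_of_pos hδ, abs_of_pos (by linarith : 0 < R + 1)]
        gcongr
    _ = δ * (R / (R + 1)) := by field_simp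
    _ ≤ δ * 1 := by
        gcongr
        rw [div_le_one (by linarith)]
        linarith
    _ = δ := mul_one δ

/-- The difference quotient of `φ` is a locally uniform limit of Riemann sums of `φ'`. -/
theorem slope_mem_derivClosure (hφ : ∀ t, HasDerivAt φ (χ t) t) (hχ : Continuous χ) {h : ℝ}
    (hh : 0 < h) : (fun t => (φ (t + h) - φ t) / h) ∈ derivClosure φ := by
  refine derivClosure_of_near fun R hR δ hδ => ?_
  have huc : UniformContinuousOn χ (Set.Icc (-R) (R + h)) :=
    isCompact_Icc.uniformContinuousOn_of_continuous hχ.continuousOn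
  obtain ⟨r, hr, hur⟩ := Metric.uniformContinuousOn_iff.1 huc δ hδ
  -- With N > h / r steps, the mesh τ = h / N is below the modulus of uniform continuity r of χ.
  obtain ⟨N, hN⟩ := exists_nat_gt (h / r)
  have hN0 : (0 : ℝ) < N := (by positivity : 0 < h / r).trans hN
  set τ := h / N with hτ
  have hτ0 : 0 < τ := by positivity
  have hNτ : N * τ = h := by rw [hτ]; field_simp
  have hτr : τ < r := by
    rw [hτ, div_lt_iff₀ hN0]
    rw [div_lt_iff₀ hr] at hN
    linarith
  refine ⟨_, Submodule.smul_mem _ (N : ℝ)⁻¹ (Submodule.sum_mem _ (t := Finset.range N)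
    (f := fun (k : ℕ) (t : ℝ) => χ (1 * t + k * τ)) fun k _ =>
      affine_comp_mem_derivClosure (deriv_mem_derivClosure hφ) one_ne_zero _), fun t ht => ?_⟩
  have ht' := abs_le.1 ht
  simp only [Pi.smul_apply, Finset.sum_apply, smul_eq_mul, one_mul]
  have tel : φ (t + h) - φ t = ∑ k ∈ Finset.range N, (φ (t + (k + 1 : ℕ) * τ) - φ (t + k * τ)) := by
    rw [Finset.sum_range_sub (fun k : ℕ => φ (t + k * τ))]
    simp [hNτ]
  have hdiff : (N : ℝ)⁻¹ * ∑ k ∈ Finset.range N, χ (t + k * τ) - (φ (t + h) - φ t) / h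
      = (N : ℝ)⁻¹ * ∑ k ∈ Finset.range N,
        (χ (t + k * τ) - (φ (t + (k + 1 : ℕ) * τ) - φ (t + k * τ)) / τ) := by
    rw [Finset.sum_sub_distrib, ← Finset.sum_div, ← tel, ← hNτ]
    generalize ∑ k ∈ Finset.range N, χ (t + k * τ) = S
    field_simp
  rw [hdiff, abs_mul, abs_of_pos (by positivity)]
  -- By the mean value theorem the slope over a mesh interval is χ ξ for some ξ in it, hence δ-close
  -- to χ at the left node.
  have term : ∀ k ∈ Finset.range N,
      |χ (t + k * τ) - (φ (t + (k + 1 : ℕ) * τ) - φ (t + k * τ)) / τ| ≤ δ := by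
    intro k hk
    have hk' : ((k + 1 : ℕ) : ℝ) ≤ N := by exact_mod_cast Finset.mem_range.1 hk
    have hlt : t + k * τ < t + (k + 1 : ℕ) * τ := by push_cast; linarith
    obtain ⟨ξ, hξ, e⟩ := exists_hasDerivAt_eq_slope φ χ hlt
      (fun x _ => (hφ x).continuousAt.continuousWithinAt) (fun x _ => hφ x)
    have hτ' : t + (k + 1 : ℕ) * τ - (t + k * τ) = τ := by push_cast; ring
    rw [hτ'] at e
    rw [← e, ← Real.dist_eq]
    have hle : (k + 1 : ℕ) * τ ≤ h := by rw [← hNτ]; gcongr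
    have hk0 : 0 ≤ k * τ := by positivity
    refine (hur _ ⟨by linarith, by linarith⟩ ξ ⟨by linarith [hξ.1], by linarith [hξ.2]⟩ ?_).le
    rw [Real.dist_eq, abs_lt]
    exact ⟨by linarith [hξ.2], by linarith [hξ.1]⟩
  calc (N : ℝ)⁻¹ * |∑ k ∈ Finset.range N,
        (χ (t + k * τ) - (φ (t + (k + 1 : ℕ) * τ) - φ (t + k * τ)) / τ)|
      ≤ (N : ℝ)⁻¹ * (N * δ) := by
        refine mul_le_mul_of_nonneg_left ?_ (by positivity)
        refine (Finset.abs_sum_le_sum_abs _ _).trans ((Finset.sum_le_sum term).trans ?_)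
        simp
    _ = δ := by field_simp

/-- The continuous function χ need not be differentiable, so the zoom is applied to a difference
quotient of φ with step y - x: its derivative at x is (χ y - χ x)/(y - x) ≠ 0. -/
theorem id_and_one_mem_derivClosure (hφ : ∀ t, HasDerivAt φ (χ t) t) (hχ : Continuous χ)
    {x y : ℝ} (hxy : χ x ≠ χ y) :
    (fun t => t) ∈ derivClosure φ ∧ (fun _ => 1) ∈ derivClosure φ := by
  wlog hlt : x < y generalizing x y
  · exact this hxy.symm (lt_of_le_of_ne (not_lt.1 hlt) fun h => hxy (h ▸ rfl))
  have h1 : (fun _ => 1) ∈ derivClosure φ := by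
    by_cases h0 : χ x = 0
    · exact one_mem_derivClosure hφ hχ (b := y) fun h => hxy (h0.trans h.symm)
    · exact one_mem_derivClosure hφ hχ h0
  refine ⟨id_mem_derivClosure_of_hasDerivAt h1
    (slope_mem_derivClosure hφ hχ (sub_pos.2 hlt)) (b := x) (κ := (χ y - χ x) / (y - x))
    (div_ne_zero (sub_ne_zero.2 hxy.symm) (sub_ne_zero.2 hlt.ne')) ?_, h1⟩
  have h2 : HasDerivAt (fun t => φ (t + (y - x))) (χ y) x := by
    have := (hφ (x + (y - x))).comp_add_const x (y - x)
    rwa [add_sub_cancel] at this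
  exact (h2.sub (hφ x)).div_const _

/-- Adding the constant θ 0 - s 0 to the network makes the error vanish at 0, so closeness of the
derivatives suffices. -/
theorem exists_oneLayer_near {θ θ' : ℝ → ℝ} (hθ : ∀ t, HasDerivAt θ (θ' t) t)
    (hmem : θ' ∈ derivClosure φ) {R ε : ℝ} (hR : 0 < R) (hε : 0 < ε) :
    ∃ s ∈ oneLayer φ, SmallOn (Set.Icc (-R) R) ε (fun t => θ t - s t) := by
  obtain ⟨s, hs, s', hd, hb⟩ := hmem R hR (ε / max 1 R) (by positivity)
  refine ⟨_, Submodule.add_mem _ hs (const_mem_oneLayer (θ 0 - s 0)), ?_⟩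
  have hm : max 1 R ≠ 0 := by positivity
  have := SmallOn.of_hasDerivAt (R := R) (δ := ε / max 1 R)
    (fun t => (hθ t).sub ((hd t).add (hasDerivAt_const t (θ 0 - s 0))))
    (fun t ht => by rw [add_zero, abs_sub_comm]; exact hb t ht) (by simp)
  rwa [div_mul_cancel₀ _ hm] at this

end OneLayer

/-! ### The closure of the networks is stable under C¹ functions -/

section NetworkClosure

variable {E : Type} [NormedAddCommGroup E] [NormedSpace ℝ E]

/-- The functions which are, in the Lipschitz norm on `K`, limits of scalar networks of any
sufficiently large depth. -/
def networkClosure (φ : ℝ → ℝ) (K : Set E) : Submodule ℝ (E → ℝ) where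
  carrier := {g | ∀ ε > 0, ∀ᶠ l in atTop, ∃ u ∈ scalarNetworks φ E l,
    SmallOn K ε (fun x => g x - u x)}
  add_mem' := by
    intro g h hg hh ε hε
    filter_upwards [hg (ε / 2) (half_pos hε), hh (ε / 2) (half_pos hε)]
    rintro l ⟨u, hu, hgu⟩ ⟨v, hv, hhv⟩
    refine ⟨u + v, Submodule.add_mem _ hu hv, ?_⟩
    convert hgu.add hhv using 2
    · ring
    · simp only [Pi.add_apply]
      ring
  zero_mem' := fun ε hε => Eventually.of_forall fun l =>
    ⟨0, Submodule.zero_mem _, by simpa using SmallOn.zero hε.le⟩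
  smul_mem' := by
    intro c g hg ε hε
    filter_upwards [hg (ε / (|c| + 1)) (by positivity)]
    rintro l ⟨u, hu, hgu⟩
    refine ⟨c • u, Submodule.smul_mem _ c hu, ?_⟩
    have := (hgu.smul c).mono (δ := ε) (by
      rw [← mul_div_assoc, div_le_iff₀ (by positivity)]
      nlinarith [abs_nonneg c])
    convert this using 2
    simp; ring

theorem mem_networkClosure_of_near {φ : ℝ → ℝ} {K : Set E} {g : E → ℝ}
    (h : ∀ ε > 0, ∃ g' ∈ networkClosure φ K, SmallOn K ε (fun x => g x - g' x)) :
    g ∈ networkClosure φ K := by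
  intro ε hε
  obtain ⟨g', hg', hgg⟩ := h (ε / 2) (half_pos hε)
  filter_upwards [hg' (ε / 2) (half_pos hε)]
  rintro l ⟨u, hu, hgu⟩
  refine ⟨u, hu, ?_⟩
  convert hgg.add hgu using 2 <;> ring

theorem mem_networkClosure_of_eventually {φ : ℝ → ℝ} {K : Set E} {g : E → ℝ}
    (h : ∀ᶠ l in atTop, g ∈ scalarNetworks φ E l) : g ∈ networkClosure φ K := fun ε hε => by
  filter_upwards [h] with l hl
  exact ⟨g, hl, by simpa using SmallOn.zero hε.le⟩

theorem oneLayer_comp_mem_scalarNetworks {φ : ℝ → ℝ} {l : ℕ} {u : E → ℝ}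
    (hu : u ∈ scalarNetworks φ E l) {s : ℝ → ℝ} (hs : s ∈ oneLayer φ) :
    (fun x => s (u x)) ∈ scalarNetworks φ E (l + 1) := by
  induction hs using Submodule.span_induction with
  | mem g hg =>
    rcases hg with ⟨a, b, rfl⟩ | rfl
    · exact comp_mem_scalarNetworks
        (Submodule.add_mem _ (Submodule.smul_mem _ a hu) (const_mem_scalarNetworks b))
    · exact const_mem_scalarNetworks 1
  | zero => exact const_mem_scalarNetworks 0
  | add g h _ _ hg hh => exact Submodule.add_mem _ hg hh
  | smul c g _ hg => exact Submodule.smul_mem _ c hg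

variable {φ χ : ℝ → ℝ} {K : Set E}

theorem exists_smallOn_comp_activation (hφ : ∀ t, HasDerivAt φ (χ t) t)
    (hχ : Continuous χ) {u : E → ℝ} {C : ℝ} (hu : SmallOn K C u) :
    ∃ C' > 0, SmallOn K C' (fun x => φ (u x)) := by
  obtain ⟨D, hD⟩ := (isCompact_Icc (a := -C) (b := C)).exists_bound_of_continuousOn hχ.continuousOn
  have h1 := SmallOn.of_hasDerivAt (R := C) (δ := D)
    (fun t => (hφ t).sub (hasDerivAt_const t (φ 0)))
    (fun t ht => by rw [sub_zero]; exact hD t (abs_le.1 ht)) (by simp)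
  have h2 := (h1.comp hu).add (SmallOn.const (φ 0))
  refine ⟨abs (D * max 1 C * max 1 C + |φ 0|) + 1, by positivity, ?_⟩
  have h3 := h2.mono (show _ ≤ abs (D * max 1 C * max 1 C + |φ 0|) + 1 from
    (le_abs_self _).trans (by linarith))
  simpa using h3

theorem exists_smallOn_of_mem_scalarNetworks (hφ : ∀ t, HasDerivAt φ (χ t) t)
    (hχ : Continuous χ) (hK : Bornology.IsBounded K) {l : ℕ} {u : E → ℝ}
    (hu : u ∈ scalarNetworks φ E l) : ∃ C > 0, SmallOn K C u := by
  induction l generalizing u with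
  | zero =>
    obtain ⟨f, c, rfl⟩ := hu
    obtain ⟨R, hR, hb⟩ := hK.exists_pos_norm_le
    refine ⟨‖f‖ * R + |c| + ‖f‖ + 1, by positivity, fun x hx => ?_, fun x hx y hy => ?_⟩
    · have h1 : |f x| ≤ ‖f‖ * R := (f.le_opNorm x).trans
        (mul_le_mul_of_nonneg_left (hb x hx) (norm_nonneg f))
      have := abs_add_le (f x) c
      have := norm_nonneg f
      linarith
    · have h1 : |f x + c - (f y + c)| ≤ ‖f‖ * ‖x - y‖ := by
        rw [add_sub_add_right_eq_sub, ← map_sub]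
        exact f.le_opNorm _
      refine h1.trans (mul_le_mul_of_nonneg_right ?_ (norm_nonneg _))
      have : 0 ≤ ‖f‖ * R := by positivity
      linarith [abs_nonneg c]
  | succ l ih =>
    induction hu using Submodule.span_induction with
    | mem g hg =>
      rcases hg with ⟨v, hv, rfl⟩ | rfl
      · obtain ⟨C, -, h⟩ := ih hv
        exact exists_smallOn_comp_activation hφ hχ h
      · exact ⟨|1|, by simp, SmallOn.const 1⟩
    | zero => exact ⟨1, one_pos, SmallOn.zero zero_le_one⟩
    | add g h _ _ hg hh =>
      obtain ⟨C, hC, h1⟩ := hg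
      obtain ⟨C', hC', h2⟩ := hh
      exact ⟨_, add_pos hC hC', h1.add h2⟩
    | smul c g _ hg =>
      obtain ⟨C, hC, h1⟩ := hg
      exact ⟨|c| * C + 1, by positivity, (h1.smul c).mono (by linarith)⟩

theorem exists_smallOn_of_mem_networkClosure (hφ : ∀ t, HasDerivAt φ (χ t) t)
    (hχ : Continuous χ) (hK : Bornology.IsBounded K) {g : E → ℝ}
    (hg : g ∈ networkClosure φ K) : ∃ C > 0, SmallOn K C g := by
  obtain ⟨l, u, hu, h⟩ := (hg 1 one_pos).exists
  obtain ⟨C, hC, h'⟩ := exists_smallOn_of_mem_scalarNetworks hφ hχ hK hu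
  exact ⟨1 + C, by positivity, by simpa using h.add h'⟩

/-- One further hidden layer imitates θ on the bounded range of u. -/
theorem exists_near_comp_of_mem_scalarNetworks (hφ : ∀ t, HasDerivAt φ (χ t) t)
    (hχ : Continuous χ) (hK : Bornology.IsBounded K) {θ θ' : ℝ → ℝ}
    (hθ : ∀ t, HasDerivAt θ (θ' t) t) (hmem : θ' ∈ derivClosure φ) {l : ℕ} {u : E → ℝ}
    (hu : u ∈ scalarNetworks φ E l) {ε : ℝ} (hε : 0 < ε) :
    ∃ w ∈ scalarNetworks φ E (l + 1), SmallOn K ε (fun x => θ (u x) - w x) := by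
  obtain ⟨C, hC, h⟩ := exists_smallOn_of_mem_scalarNetworks hφ hχ hK hu
  have hm : max 1 C ≠ 0 := by positivity
  obtain ⟨s, hs, hsθ⟩ := exists_oneLayer_near hθ hmem hC (ε := ε / max 1 C) (by positivity)
  refine ⟨_, oneLayer_comp_mem_scalarNetworks hu hs, ?_⟩
  have := hsθ.comp h
  rwa [div_mul_cancel₀ _ hm] at this

variable {x₀ y₀ : ℝ}

/-- Depth can be padded: the identity has derivative 1, which lies in `derivClosure φ`, so a further
layer imitates it with arbitrarily small error. -/
theorem scalarNetworks_le_networkClosure (hφ : ∀ t, HasDerivAt φ (χ t) t)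
    (hχ : Continuous χ) (hK : Bornology.IsBounded K) (hne : χ x₀ ≠ χ y₀)
    (l : ℕ) :
    scalarNetworks φ E l ≤ networkClosure φ K := by
  intro u hu ε hε
  refine eventually_atTop.2 ⟨l, fun l' hl => ?_⟩
  induction l', hl using Nat.le_induction generalizing ε with
  | base => exact ⟨u, hu, by simpa using SmallOn.zero hε.le⟩
  | succ m hm ih =>
    obtain ⟨v, hv, h⟩ := ih (ε / 2) (half_pos hε)
    obtain ⟨w, hw, h'⟩ := exists_near_comp_of_mem_scalarNetworks hφ hχ hK (fun t => hasDerivAt_id' t)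
      (id_and_one_mem_derivClosure hφ hχ hne).2 hv (half_pos hε)
    refine ⟨w, hw, ?_⟩
    convert h.add h' using 2 <;> ring

theorem sq_mem_networkClosure (hφ : ∀ t, HasDerivAt φ (χ t) t)
    (hχ : Continuous χ) (hK : Bornology.IsBounded K) (hne : χ x₀ ≠ χ y₀)
    {g : E → ℝ} (hg : g ∈ networkClosure φ K) :
    (fun x => g x ^ 2) ∈ networkClosure φ K := by
  intro ε hε
  obtain ⟨C, hC, hgC⟩ := exists_smallOn_of_mem_networkClosure hφ hχ hK hg
  have hsq : ∀ t : ℝ, HasDerivAt (fun t => t ^ 2) (2 * t) t := fun t => by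
    simpa using hasDerivAt_pow 2 t
  -- The error is g² - u² = (g - u)(g + u), and g + u = 2g - (g - u) has size at most 2C + 1 as δ ≤
  -- 1. The product bound 2δ(2C + 1) is then at most ε / 2, which leaves ε / 2 for the extra layer.
  set δ := min 1 (ε / (4 * (2 * C + 1))) with hδ
  have hδ0 : 0 < δ := by positivity
  obtain ⟨m, hm⟩ := eventually_atTop.1 (hg δ hδ0)
  refine eventually_atTop.2 ⟨m + 1, fun l hl => ?_⟩
  obtain ⟨k, rfl⟩ : ∃ k, l = k + 1 := ⟨l - 1, by omega⟩
  obtain ⟨u, hu, hgu⟩ := hm k (by omega)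
  obtain ⟨w, hw, h⟩ := exists_near_comp_of_mem_scalarNetworks hφ hχ hK hsq
    (Submodule.smul_mem _ 2 (id_and_one_mem_derivClosure hφ hχ hne).1) hu (half_pos hε)
  refine ⟨w, hw, ?_⟩
  have h1 : SmallOn K (2 * C + 1) (fun x => g x + u x) := by
    have h2 := (hgC.add hgC).add (hgu.smul (-1))
    have h3 := h2.mono (δ := 2 * C + 1) (by
      simp only [abs_neg, abs_one, one_mul]
      linarith [min_le_left 1 (ε / (4 * (2 * C + 1)))])
    convert h3 using 2
    ring
  have h4 := ((hgu.mul h1).mono (δ := ε / 2) (by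
    have : δ ≤ ε / (4 * (2 * C + 1)) := min_le_right _ _
    calc 2 * (δ * (2 * C + 1)) ≤ 2 * (ε / (4 * (2 * C + 1)) * (2 * C + 1)) := by gcongr
      _ = ε / 2 := by field_simp; ring)).add h
  convert h4 using 2 <;> ring

/-- Polarization: 2gh = (g + h)² - g² - h². -/
theorem mul_mem_networkClosure (hφ : ∀ t, HasDerivAt φ (χ t) t)
    (hχ : Continuous χ) (hK : Bornology.IsBounded K) (hne : χ x₀ ≠ χ y₀)
    {g h : E → ℝ} (hg : g ∈ networkClosure φ K)
    (hh : h ∈ networkClosure φ K) : (fun x => g x * h x) ∈ networkClosure φ K := by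
  have sq := fun {g} hg => sq_mem_networkClosure hφ hχ hK hne (g := g) hg
  have := Submodule.smul_mem _ (1 / 2 : ℝ)
    (Submodule.sub_mem _ (Submodule.sub_mem _ (sq (Submodule.add_mem _ hg hh)) (sq hg)) (sq hh))
  convert this using 1
  ext x
  simp; ring

theorem polynomial_comp_mem_networkClosure (hφ : ∀ t, HasDerivAt φ (χ t) t)
    (hχ : Continuous χ) (hK : Bornology.IsBounded K) (hne : χ x₀ ≠ χ y₀)
    {g : E → ℝ} (hg : g ∈ networkClosure φ K)
    (p : Polynomial ℝ) : (fun x => p.eval (g x)) ∈ networkClosure φ K := by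
  induction p using Polynomial.induction_on' with
  | add p q hp hq =>
    simp only [Polynomial.eval_add]
    exact Submodule.add_mem _ hp hq
  | monomial n a =>
    simp only [Polynomial.eval_monomial]
    refine Submodule.smul_mem _ a ?_
    induction n with
    | zero =>
      simpa using scalarNetworks_le_networkClosure hφ hχ hK hne 0 (const_mem_scalarNetworks 1)
    | succ n ih =>
      simpa [pow_succ] using mul_mem_networkClosure hφ hχ hK hne ih hg

theorem exists_polynomial_hasDerivAt (q : Polynomial ℝ) :
    ∃ p : Polynomial ℝ, ∀ t, HasDerivAt (fun t => p.eval t) (q.eval t) t := by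
  suffices ∃ p : Polynomial ℝ, p.derivative = q by
    obtain ⟨p, rfl⟩ := this
    exact ⟨p, fun t => p.hasDerivAt t⟩
  induction q using Polynomial.induction_on' with
  | add q r hq hr =>
    obtain ⟨p, rfl⟩ := hq
    obtain ⟨p', rfl⟩ := hr
    exact ⟨p + p', by simp⟩
  | monomial n a =>
    refine ⟨Polynomial.monomial (n + 1) (a / (n + 1)), ?_⟩
    rw [Polynomial.derivative_monomial]
    congr 1
    push_cast
    field_simp

/-- Weierstrass is applied to θ', not θ: an antiderivative of the approximating polynomial,
normalized at 0, is close to θ in the Lipschitz norm on the range of g. -/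
theorem comp_mem_networkClosure (hφ : ∀ t, HasDerivAt φ (χ t) t)
    (hχ : Continuous χ) (hK : Bornology.IsBounded K) (hne : χ x₀ ≠ χ y₀)
    {θ θ' : ℝ → ℝ} (hθ : ∀ t, HasDerivAt θ (θ' t) t)
    (hθ' : Continuous θ') {g : E → ℝ} (hg : g ∈ networkClosure φ K) :
    (fun x => θ (g x)) ∈ networkClosure φ K := by
  refine mem_networkClosure_of_near fun ε hε => ?_
  obtain ⟨C, hC, hgC⟩ := exists_smallOn_of_mem_networkClosure hφ hχ hK hg
  have hm : max 1 C ≠ 0 := by positivity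
  -- One factor `max 1 C` is lost in passing from the derivative to the function, the other in
  -- composing with g.
  obtain ⟨q, hq⟩ := exists_polynomial_near_of_continuousOn (-C) C θ' hθ'.continuousOn
    (ε / max 1 C / max 1 C) (by positivity)
  obtain ⟨p, hp⟩ := exists_polynomial_hasDerivAt q
  have hd : ∀ t, HasDerivAt (fun t => θ t - ((p + Polynomial.C (θ 0 - p.eval 0)).eval t))
      (θ' t - q.eval t) t := fun t => by
    simp only [Polynomial.eval_add, Polynomial.eval_C]
    exact (hθ t).sub ((hp t).add_const (θ 0 - p.eval 0))
  refine ⟨_, polynomial_comp_mem_networkClosure hφ hχ hK hne hg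
    (p + Polynomial.C (θ 0 - p.eval 0)), ?_⟩
  have h1 := (SmallOn.of_hasDerivAt hd (R := C) (fun t ht => by
    rw [abs_sub_comm]
    exact (hq t (abs_le.1 ht)).le) (by simp)).comp hgC
  rwa [div_mul_cancel₀ _ hm, div_mul_cancel₀ _ hm] at h1

end NetworkClosure

/-! ### Density of networks with prescribed Lipschitz constant and bound -/

/-- The function √(t² + η²) has derivative of modulus at most 1 and lies between |t| and |t| + η. -/
theorem exists_smooth_abs {η : ℝ} (hη : 0 < η) :
    ∃ θ θ' : ℝ → ℝ, (∀ t, HasDerivAt θ (θ' t) t) ∧ Continuous θ' ∧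
      (∀ s t, |θ s - θ t| ≤ |s - t|) ∧ ∀ t, abs (θ t - |t|) ≤ η := by
  have pos : ∀ t : ℝ, 0 < t ^ 2 + η ^ 2 := fun t => by positivity
  have hd : ∀ t : ℝ, HasDerivAt (fun t => √(t ^ 2 + η ^ 2)) (t / √(t ^ 2 + η ^ 2)) t := fun t => by
    have h1 : HasDerivAt (fun t : ℝ => t ^ 2 + η ^ 2) (2 * t) t := by
      simpa using (hasDerivAt_pow 2 t).add_const (η ^ 2)
    convert h1.sqrt (pos t).ne' using 1
    rw [mul_div_mul_left _ _ two_ne_zero]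
  refine ⟨_, _, hd, ?_, fun s t => ?_, fun t => ?_⟩
  · exact continuous_id.div (by fun_prop) fun t => (Real.sqrt_pos.2 (pos t)).ne'
  · have := convex_univ.norm_image_sub_le_of_norm_hasDerivWithin_le (C := 1)
      (fun x _ => (hd x).hasDerivWithinAt) (fun x _ => ?_) (Set.mem_univ t) (Set.mem_univ s)
    · simpa using this
    · rw [norm_div, Real.norm_of_nonneg (Real.sqrt_nonneg _),
        div_le_one (Real.sqrt_pos.2 (pos x)), Real.norm_eq_abs]
      exact Real.abs_le_sqrt (by nlinarith)
  · have h1 : |t| ≤ √(t ^ 2 + η ^ 2) := Real.abs_le_sqrt (by nlinarith)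
    have h2 : √(t ^ 2 + η ^ 2) ≤ |t| + η := by
      refine Real.sqrt_le_iff.2 ⟨by positivity, ?_⟩
      nlinarith [abs_nonneg t, sq_abs t]
    exact abs_le.2 ⟨by linarith, by linarith⟩

section Density

variable {E : Type} [NormedAddCommGroup E] [InnerProductSpace ℝ E]

theorem exists_networkClosure_near {φ : ℝ → ℝ} (hφ : IsAdmissibleActivation φ) {K : Set E}
    (hK : IsCompact K) (hne : K.Nonempty) {L : ℝ} {f : E → ℝ} (hf : LipOn K L f) {ε : ℝ}
    (hε : 0 < ε) : ∃ g ∈ networkClosure φ K, LipOn K L g ∧ ∀ x ∈ K, |g x - f x| ≤ ε := by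
  rcases hφ with ⟨hC, hpoly⟩ | rfl
  · have hd : ∀ t, HasDerivAt φ (deriv φ t) t := fun t =>
      (hC.differentiable one_ne_zero t).hasDerivAt
    have hc : Continuous (deriv φ) := hC.continuous_deriv le_rfl
    -- A constant derivative would make φ affine, hence a polynomial.
    obtain ⟨x, y, hxy⟩ : ∃ x y, deriv φ x ≠ deriv φ y := by
      by_contra! hcon
      refine hpoly ⟨Polynomial.C (deriv φ 0) * Polynomial.X + Polynomial.C (φ 0), fun x => ?_⟩
      have hd' : ∀ t, HasDerivAt (fun t => φ t - deriv φ 0 * t) 0 t := fun t => by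
        have := (hd t).sub ((hasDerivAt_id t).const_mul (deriv φ 0))
        rw [mul_one, hcon t 0, sub_self] at this
        exact this
      have := is_const_of_deriv_eq_zero (fun t => (hd' t).differentiableAt)
        (fun t => (hd' t).deriv) x 0
      simp at this ⊢
      linarith
    refine exists_near_lipOn_of_smoothAbs hK hne _ (fun l c =>
      scalarNetworks_le_networkClosure hd hc hK.isBounded hxy 0 ⟨l, c, rfl⟩) (fun η hη => ?_) hf hε
    obtain ⟨θ, θ', h1, h2, h3, h4⟩ := exists_smooth_abs hη
    exact ⟨θ, h3, h4, fun g hg => comp_mem_networkClosure hd hc hK.isBounded hxy h1 h2 hg⟩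
  -- The choice σ = -1 reproduces u, so depth can be increased exactly; σ = 1 gives |u|.
  · have comp : ∀ l, ∀ u ∈ scalarNetworks (fun x => max x 0) E l, ∀ σ : ℝ,
        (fun x => max (u x) 0 + σ * max (-u x) 0) ∈ scalarNetworks (fun x => max x 0) E (l + 1) :=
      fun l u hu σ => Submodule.add_mem _ (comp_mem_scalarNetworks hu)
        (Submodule.smul_mem _ σ (comp_mem_scalarNetworks (Submodule.neg_mem _ hu)))
    have up : ∀ l, ∀ u ∈ scalarNetworks (fun x => max x 0) E l,
        u ∈ scalarNetworks (fun x => max x 0) E (l + 1) := fun l u hu => by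
      convert comp l u hu (-1) using 1
      ext x
      rcases le_total (u x) 0 with h | h
      · rw [max_eq_right h, max_eq_left (by linarith)]; ring
      · rw [max_eq_left h, max_eq_right (by linarith)]; ring
    have mono : Monotone fun l => scalarNetworks (fun x => max x 0) E l :=
      monotone_nat_of_le_succ up
    let A : Submodule ℝ (E → ℝ) :=
      { carrier := {g | ∀ᶠ l in atTop, g ∈ scalarNetworks (fun x => max x 0) E l}
        add_mem' := fun ha hb => by
          filter_upwards [ha, hb] with l h h' using Submodule.add_mem _ h h'
        zero_mem' := Eventually.of_forall fun l => Submodule.zero_mem _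
        smul_mem' := fun c g hg => by
          filter_upwards [hg] with l h using Submodule.smul_mem _ c h }
    have hA : ∀ l, ∀ u ∈ scalarNetworks (fun x => max x 0) E l, u ∈ A := fun l u hu =>
      eventually_atTop.2 ⟨l, fun m hm => mono hm hu⟩
    obtain ⟨g, hg, h⟩ := exists_near_lipOn_of_smoothAbs hK hne A
      (fun l c => hA 0 _ ⟨l, c, rfl⟩) (fun η hη => ⟨fun t => |t|, abs_abs_sub_abs_le,
        fun t => by simpa using hη.le, fun g hg => by
          obtain ⟨l, hl⟩ := Eventually.exists hg
          convert hA _ _ (comp l g hl 1) using 1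
          ext x
          show |g x| = _
          rcases le_total (g x) 0 with h | h
          · rw [max_eq_right h, max_eq_left (by linarith), abs_of_nonpos h]; ring
          · rw [max_eq_left h, max_eq_right (by linarith), abs_of_nonneg h]; ring⟩) hf hε
    exact ⟨g, mem_networkClosure_of_eventually hg, h⟩

/-- A network near f in the Lipschitz norm may exceed L and B slightly; multiplication by 1 - τ
restores both constants and moves the values by little. -/
theorem eventually_exists_scalarNetworks_near {φ : ℝ → ℝ} (hφ : IsAdmissibleActivation φ)
    {K : Set E} (hK : IsCompact K) (hne : K.Nonempty) {B L : ℝ} (hB : 0 < B) (hL : 0 < L)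
    {f : E → ℝ} (hf : LipOn K L f) (hfB : ∀ x ∈ K, |f x| ≤ B) {ε : ℝ} (hε : 0 < ε) :
    ∀ᶠ l in atTop, ∃ u ∈ scalarNetworks φ E l, LipOn K L u ∧ ∀ x ∈ K,
      |u x| ≤ B ∧ |u x - f x| ≤ ε := by
  -- The approximating u is (L + δ)-Lipschitz and bounded by B + 2δ. With δ ≤ τL and 2δ ≤ τB the
  -- contraction brings these below L and B, and the total error is at most 2δ + τ(B + 2δ) ≤ 3Bτ ≤
  -- ε.
  set τ := min (1 / 2) (ε / (3 * B)) with hτ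
  have hτ0 : 0 < τ := by positivity
  have hτ1 : τ ≤ 1 / 2 := min_le_left _ _
  have hτε : 3 * B * τ ≤ ε := by
    have : τ ≤ ε / (3 * B) := min_le_right _ _
    rw [le_div_iff₀ (by positivity)] at this
    linarith
  set δ := min (τ * L) (τ * B / 2) with hδ
  have hδ0 : 0 < δ := by positivity
  have hδL : δ ≤ τ * L := min_le_left _ _
  have hδB : 2 * δ ≤ τ * B := by linarith [min_le_right (τ * L) (τ * B / 2)]
  obtain ⟨g, hg, hgL, hgf⟩ := exists_networkClosure_near hφ hK hne hf hδ0
  filter_upwards [hg δ hδ0]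
  rintro l ⟨u, hu, hgu⟩
  refine ⟨(1 - τ) • u, Submodule.smul_mem _ _ hu, fun x hx y hy => ?_, fun x hx => ?_⟩
  · have h1 := hgL x hx y hy
    have h2 := hgu.2 x hx y hy
    have h3 : |u x - u y| ≤ (L + δ) * ‖x - y‖ := by
      rw [add_mul]
      calc |u x - u y| = |(g x - g y) - (g x - u x - (g y - u y))| := by ring_nf
        _ ≤ _ := (abs_sub _ _).trans (add_le_add h1 h2)
    simp only [Pi.smul_apply, smul_eq_mul]
    rw [← mul_sub, abs_mul, abs_of_nonneg (by linarith : 0 ≤ 1 - τ)]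
    calc (1 - τ) * |u x - u y| ≤ (1 - τ) * ((L + δ) * ‖x - y‖) :=
          mul_le_mul_of_nonneg_left h3 (by linarith)
      _ = ((1 - τ) * (L + δ)) * ‖x - y‖ := by ring
      _ ≤ L * ‖x - y‖ := by
          refine mul_le_mul_of_nonneg_right ?_ (norm_nonneg _)
          nlinarith
  · have h1 := abs_le.1 (hgf x hx)
    have h2 := abs_le.1 (hgu.1 x hx)
    have h3 := abs_le.1 (hfB x hx)
    have h4 : |u x| ≤ B + 2 * δ := abs_le.2 ⟨by linarith, by linarith⟩
    have h5 : (1 - τ) * |u x| ≤ (1 - τ) * (B + 2 * δ) :=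
      mul_le_mul_of_nonneg_left h4 (by linarith)
    have h6 : τ * |u x| ≤ τ * (B + 2 * δ) := mul_le_mul_of_nonneg_left h4 hτ0.le
    have h7 : τ * B ≤ B / 2 := by nlinarith
    have h8 : τ * (τ * B) ≤ τ * B := by nlinarith [mul_pos hτ0 hB]
    have h9 : τ * (2 * δ) ≤ τ * (τ * B) := mul_le_mul_of_nonneg_left hδB hτ0.le
    simp only [Pi.smul_apply, smul_eq_mul]
    constructor
    · rw [abs_mul, abs_of_nonneg (by linarith : 0 ≤ 1 - τ)]
      refine h5.trans ?_
      nlinarith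
    · have h10 := abs_le.1 (show |τ * u x| ≤ τ * (B + 2 * δ) by
        rw [abs_mul, abs_of_pos hτ0]; exact h6)
      exact abs_le.2 ⟨by linarith, by linarith⟩

/-- Networks with Lipschitz constant `L` and bound `B` are dense in the functions with Lipschitz
constant `L` and bound `B`. -/
theorem exists_neuralNetworks_near {φ : ℝ → ℝ} (hφ : IsAdmissibleActivation φ)
    {K : Set E} (hK : IsCompact K) (hne : K.Nonempty) {B L : ℝ} (hB : 0 < B) (hL : 0 < L)
    {d : ℕ} {f : Fin d → E → ℝ} (hf : ∀ j, LipOn K L (f j)) (hfB : ∀ j, ∀ x ∈ K, |f j x| ≤ B)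
    {ε : ℝ} (hε : 0 < ε) :
    ∃ g ∈ neuralNetworks φ E d, ∀ j, LipOn K L (fun x => g x j) ∧ ∀ x ∈ K,
      |g x j| ≤ B ∧ |g x j - f j x| ≤ ε := by
  have := eventually_all.2 fun j =>
    eventually_exists_scalarNetworks_near hφ hK hne hB hL (hf j) (hfB j) hε
  -- Every large depth works for each coordinate, so a common one exists; l + 1 ensures at least one
  -- hidden layer.
  obtain ⟨l, hl⟩ := eventually_atTop.1 this
  choose u hu h using hl (l + 1) (by omega)
  exact ⟨_, mem_neuralNetworks_of_mem_scalarNetworks hu, h⟩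

end Density

/-! ### Payoffs, compactness of strategies, approximation by network strategies -/

namespace Market

variable {d n : ℕ} (M : Market d n)

theorem isCompact_histories (i : ℕ) : IsCompact (M.histories i) := by
  have h : IsCompact (Set.univ.pi fun p : Fin i × Fin d => Set.Icc (M.lo p.2) (M.hi p.2)) :=
    isCompact_univ_pi fun _ => isCompact_Icc
  convert h.image (EuclideanSpace.equiv (Fin i × Fin d) ℝ).symm.continuous using 1
  ext y
  constructor
  · intro hy
    exact ⟨EuclideanSpace.equiv _ ℝ y, fun p _ => hy p, by simp⟩
  · rintro ⟨z, hz, rfl⟩ p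
    exact hz p (Set.mem_univ p)

theorem history_mem (x : M.Omega) {i : ℕ} (hi : i ≤ n) : M.history x hi ∈ M.histories i :=
  fun p => (x (Fin.castLE hi p.1) p.2).2

theorem histories_nonempty (i : ℕ) : (M.histories i).Nonempty :=
  ⟨WithLp.toLp 2 fun p => (M.spot p.2 : ℝ), fun p => (M.spot p.2).2⟩

theorem measurable_price (i : Fin (n + 1)) : Measurable fun x : M.Omega => M.price x i := by
  refine Fin.cases ?_ (fun k => ?_) i
  · exact measurable_const
  · exact measurable_pi_apply k

theorem measurable_terminal : Measurable M.terminal := M.measurable_price (Fin.last n)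

theorem measurable_history {i : ℕ} (hi : i ≤ n) : Measurable fun x : M.Omega => M.history x hi := by
  refine (WithLp.measurable_toLp 2 _).comp (measurable_pi_iff.2 fun p => ?_)
  exact measurable_subtype_coe.comp
    ((measurable_pi_apply p.2).comp (measurable_pi_apply (Fin.castLE hi p.1)))

variable {M} in
theorem continuous_of_mem_admissible {B L : ℝ} {p : ℝ × Strategy d n} (hp : p ∈ M.admissible B L)
    (i : Fin n) (j : Fin d) : Continuous (p.2 i j) := by
  have : LipOn Set.univ L (p.2 i j) := fun y _ z _ => (hp.2 i j).1 y z
  exact continuousOn_univ.1 this.continuousOn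

theorem measurable_position {Δ : Strategy d n} (hΔ : ∀ i j, Continuous (Δ i j)) (j : Fin d)
    (i : ℕ) : Measurable fun x => M.position Δ x j i := by
  unfold position
  split_ifs with h
  · exact (hΔ _ j).measurable.comp (M.measurable_history h.le)
  · exact measurable_const

theorem measurable_prevPosition {Δ : Strategy d n} (hΔ : ∀ i j, Continuous (Δ i j)) (j : Fin d)
    (i : ℕ) : Measurable fun x => M.prevPosition Δ x j i := by
  cases i with
  | zero => exact measurable_const
  | succ i => exact M.measurable_position hΔ j i

theorem measurable_payoff {p : ℝ × Strategy d n} (hΔ : ∀ i j, Continuous (p.2 i j)) :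
    Measurable (M.payoff p) := by
  have hpr : ∀ (i : Fin (n + 1)) (j : Fin d), Measurable fun x : M.Omega => (M.price x i j : ℝ) :=
    fun i j => measurable_subtype_coe.comp ((measurable_pi_apply j).comp (M.measurable_price i))
  refine (measurable_const.add ?_).sub ?_
  · exact Finset.measurable_sum _ fun j _ => Finset.measurable_sum _ fun i _ =>
      (M.measurable_position hΔ j i).mul ((hpr _ j).sub (hpr _ j))
  · refine Finset.measurable_sum _ fun j _ => Finset.measurable_sum _ fun i _ => ?_
    have h1 := (M.measurable_position hΔ j i).sub (M.measurable_prevPosition hΔ j i)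
    exact (((M.cTrans_measurable i j).comp ((hpr i j).prodMk h1)).add
      ((M.cSpread_measurable i j).comp ((hpr i j).prodMk h1))).add
      ((M.cShort_measurable i j).comp ((hpr i j).prodMk (M.measurable_position hΔ j i)))

variable {M}

theorem abs_position_le {B L : ℝ} (hB : 0 ≤ B) {p : ℝ × Strategy d n} (hp : p ∈ M.admissible B L)
    (x : M.Omega) (j : Fin d) (i : ℕ) : |M.position p.2 x j i| ≤ B := by
  unfold position
  split_ifs with h
  · exact (hp.2 _ j).2 _ (M.history_mem x h.le)
  · simpa using hB

theorem abs_prevPosition_le {B L : ℝ} (hB : 0 ≤ B) {p : ℝ × Strategy d n}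
    (hp : p ∈ M.admissible B L) (x : M.Omega) (j : Fin d) (i : ℕ) :
    |M.prevPosition p.2 x j i| ≤ B := by
  cases i with
  | zero => simpa [prevPosition] using hB
  | succ i => exact abs_position_le hB hp x j i

theorem exists_abs_payoff_le (hbdd : M.LocallyBoundedCosts) {B : ℝ} (hB : 0 ≤ B) (L : ℝ) :
    ∃ R, ∀ p ∈ M.admissible B L, ∀ x, |M.payoff p x| ≤ R := by
  -- A trade is the difference of two positions bounded by B, hence bounded by 2B.
  choose C hC using fun i j => hbdd i j (2 * B)
  refine ⟨B + (∑ j : Fin d, ∑ _i : Fin n, B * (M.hi j - M.lo j))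
    + ∑ j : Fin d, ∑ i : Fin (n + 1), 3 * C i j, fun p hp x => ?_⟩
  have h1 : |M.grossProfit p.2 x| ≤ ∑ j : Fin d, ∑ _i : Fin n, B * (M.hi j - M.lo j) := by
    refine (Finset.abs_sum_le_sum_abs _ _).trans (Finset.sum_le_sum fun j _ => ?_)
    refine (Finset.abs_sum_le_sum_abs _ _).trans (Finset.sum_le_sum fun i _ => ?_)
    rw [abs_mul]
    refine mul_le_mul (abs_position_le hB hp x j i) ?_ (abs_nonneg _) hB
    have ha := (M.price x i.succ j).2
    have hb := (M.price x i.castSucc j).2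
    exact abs_le.2 ⟨by linarith [ha.1, hb.2], by linarith [ha.2, hb.1]⟩
  have h2 : |M.tradingCosts p.2 x| ≤ ∑ j : Fin d, ∑ i : Fin (n + 1), 3 * C i j := by
    refine (Finset.abs_sum_le_sum_abs _ _).trans (Finset.sum_le_sum fun j _ => ?_)
    refine (Finset.abs_sum_le_sum_abs _ _).trans (Finset.sum_le_sum fun i _ => ?_)
    have hp1 := abs_position_le hB hp x j i
    have hp2 := abs_prevPosition_le hB hp x j i
    have h3 := hC i j _ (M.price x i j).2 (M.position p.2 x j i - M.prevPosition p.2 x j i)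
      ((abs_sub _ _).trans (by linarith))
    have h4 := hC i j _ (M.price x i j).2 (M.position p.2 x j i) (by linarith)
    have n1 := M.cTrans_nonneg i j (M.price x i j)
      (M.position p.2 x j i - M.prevPosition p.2 x j i)
    have n2 := M.cSpread_nonneg i j (M.price x i j)
      (M.position p.2 x j i - M.prevPosition p.2 x j i)
    have n3 := M.cShort_nonneg i j (M.price x i j) (M.position p.2 x j i)
    rw [abs_of_nonneg (by linarith)]
    linarith [h3.1, h3.2.1, h4.2.2]
  have h3 := abs_sub (p.1 + M.grossProfit p.2 x) (M.tradingCosts p.2 x)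
  have h4 := abs_add_le p.1 (M.grossProfit p.2 x)
  have h5 : |p.1| ≤ B := hp.1
  unfold payoff
  linarith

variable (M) in
/-- Convergence of the initial capital, and pointwise convergence of the positions on the set of
possible price histories. -/
def ConvergesTo (q : ℕ → ℝ × Strategy d n) (p : ℝ × Strategy d n) : Prop :=
  Tendsto (fun m => (q m).1) atTop (𝓝 p.1) ∧ ∀ (i : Fin n) (j : Fin d), ∀ y ∈ M.histories i,
    Tendsto (fun m => (q m).2 i j y) atTop (𝓝 (p.2 i j y))

theorem ConvergesTo.position {q : ℕ → ℝ × Strategy d n} {p : ℝ × Strategy d n}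
    (h : M.ConvergesTo q p) (x : M.Omega) (j : Fin d) (i : ℕ) :
    Tendsto (fun m => M.position (q m).2 x j i) atTop (𝓝 (M.position p.2 x j i)) := by
  unfold Market.position
  split_ifs with hi
  · exact h.2 _ j _ (M.history_mem x hi.le)
  · exact tendsto_const_nhds

theorem ConvergesTo.prevPosition {q : ℕ → ℝ × Strategy d n} {p : ℝ × Strategy d n}
    (h : M.ConvergesTo q p) (x : M.Omega) (j : Fin d) (i : ℕ) :
    Tendsto (fun m => M.prevPosition (q m).2 x j i) atTop (𝓝 (M.prevPosition p.2 x j i)) := by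
  cases i with
  | zero => exact tendsto_const_nhds
  | succ i => exact h.position x j i

/-- Along a fixed path the prices are fixed, so continuity of the costs in the position variable is
enough. -/
theorem ConvergesTo.payoff (hcont : M.ContinuousCosts) {q : ℕ → ℝ × Strategy d n}
    {p : ℝ × Strategy d n} (h : M.ConvergesTo q p) (x : M.Omega) :
    Tendsto (fun m => M.payoff (q m) x) atTop (𝓝 (M.payoff p x)) := by
  refine (h.1.add ?_).sub ?_
  · exact tendsto_finsetSum _ fun j _ => tendsto_finsetSum _ fun i _ =>
      (h.position x j i).mul_const _
  · refine tendsto_finsetSum _ fun j _ => tendsto_finsetSum _ fun i _ => ?_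
    have h1 := (h.position x j i).sub (h.prevPosition x j i)
    obtain ⟨c1, c2, c3⟩ := hcont i j (M.price x i j)
    exact (((c1.tendsto _).comp h1).add ((c2.tendsto _).comp h1)).add
      ((c3.tendsto _).comp (h.position x j i))

/-- Arzelà–Ascoli: by Tychonoff a subsequence converges at a countable dense set of histories, and
the common Lipschitz constant extends convergence to every point. The bounds pass to pointwise
limits. -/
theorem exists_subseq_convergesTo {B L : ℝ} (hL : 0 < L) {q : ℕ → ℝ × Strategy d n}
    (hq : ∀ m, q m ∈ M.admissible B L) :
    ∃ ns : ℕ → ℕ, StrictMono ns ∧ ∃ p ∈ M.admissible B L,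
      M.ConvergesTo (fun m => q (ns m)) p := by
  choose y₀ hy₀ using fun i => M.histories_nonempty i
  let D : (i : ℕ) → ℕ → EuclideanSpace ℝ (Fin i × Fin d) := fun i => TopologicalSpace.denseSeq _
  -- The dense points range over all of ℝ^{id}, where the bound B is not available; the Lipschitz
  -- condition supplies one from a base point in Ωᵢ.
  have hbound : ∀ m (i : Fin n) j y, |(q m).2 i j y| ≤ B + L * ‖y - y₀ i‖ := fun m i j y => by
    have h1 := ((hq m).2 i j).1 y (y₀ i)
    have h2 := ((hq m).2 i j).2 _ (hy₀ i)
    have h3 := abs_sub_abs_le_abs_sub ((q m).2 i j y) ((q m).2 i j (y₀ i))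
    linarith
  let b : Fin n → ℕ → ℝ := fun i k => B + L * ‖D i k - y₀ i‖
  have hcomp : IsCompact (Set.Icc (-B) B ×ˢ Set.univ.pi fun i : Fin n => Set.univ.pi
      fun _ : Fin d => Set.univ.pi fun k : ℕ => Set.Icc (-b i k) (b i k)) :=
    isCompact_Icc.prod (isCompact_univ_pi fun i => isCompact_univ_pi fun j =>
      isCompact_univ_pi fun k => isCompact_Icc)
  obtain ⟨a, -, ns, hns, ha⟩ := hcomp.tendsto_subseq
    (x := fun m => ((q m).1, fun (i : Fin n) (j : Fin d) (k : ℕ) => (q m).2 i j (D i k)))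
    (fun m => ⟨abs_le.1 (hq m).1, fun i _ j _ k _ => abs_le.1 (hbound m i j (D i k))⟩)
  have hlim : ∀ (i : Fin n) (j : Fin d) y, ∃ v, Tendsto (fun m => (q (ns m)).2 i j y) atTop (𝓝 v) := by
    intro i j y
    refine cauchySeq_tendsto_of_complete (Metric.cauchySeq_iff'.2 fun ε hε => ?_)
    obtain ⟨k, hk⟩ := (TopologicalSpace.denseRange_denseSeq
      (EuclideanSpace ℝ (Fin i × Fin d))).exists_dist_lt y (show 0 < ε / (4 * L) by positivity)
    have hk' : L * ‖y - D i k‖ ≤ ε / 4 := by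
      rw [dist_eq_norm, lt_div_iff₀ (by positivity)] at hk
      linarith [show ‖y - D i k‖ * (4 * L) < ε from hk]
    have hc : Tendsto (fun m => (q (ns m)).2 i j (D i k)) atTop (𝓝 (a.2 i j k)) :=
      tendsto_pi_nhds.1 (tendsto_pi_nhds.1 (tendsto_pi_nhds.1
        ((continuous_snd.tendsto _).comp ha) i) j) k
    obtain ⟨N, hN⟩ := Metric.cauchySeq_iff'.1 hc.cauchySeq (ε / 4) (by positivity)
    refine ⟨N, fun m hm => ?_⟩
    have h1 := abs_le.1 (((hq (ns m)).2 i j).1 y (D i k))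
    have h2 := abs_le.1 (((hq (ns N)).2 i j).1 y (D i k))
    have h3 := abs_lt.1 (hN m hm)
    rw [Real.dist_eq, abs_lt]
    constructor <;> linarith
  choose v hv using hlim
  refine ⟨ns, hns, (a.1, v), ⟨?_, fun i j => ⟨fun y z => ?_, fun y hy => ?_⟩⟩,
    (continuous_fst.tendsto a).comp ha, fun i j y _ => hv i j y⟩
  · exact le_of_tendsto ((continuous_fst.tendsto _).comp ha).abs
      (Eventually.of_forall fun m => (hq (ns m)).1)
  · exact le_of_tendsto ((hv i j y).sub (hv i j z)).abs
      (Eventually.of_forall fun m => ((hq (ns m)).2 i j).1 y z)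
  · exact le_of_tendsto (hv i j y).abs
      (Eventually.of_forall fun m => ((hq (ns m)).2 i j).2 y hy)

theorem exists_nnAdmissible_convergesTo {φ : ℝ → ℝ} (hφ : IsAdmissibleActivation φ) {B L : ℝ}
    (hB : 0 < B) (hL : 0 < L) {p : ℝ × Strategy d n} (hp : p ∈ M.admissible B L) :
    ∃ q : ℕ → ℝ × Strategy d n, (∀ m, q m ∈ M.nnAdmissible φ B L) ∧ M.ConvergesTo q p := by
  have key : ∀ (m : ℕ) (i : Fin n), ∃ Δ : Fin d → EuclideanSpace ℝ (Fin (i : ℕ) × Fin d) → ℝ,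
      (∀ j, (∀ y z, |Δ j y - Δ j z| ≤ L * ‖y - z‖) ∧ ∀ y ∈ M.histories i, |Δ j y| ≤ B) ∧
      (∃ f ∈ M.boundedNetworks φ B L i, ∀ y ∈ M.histories i, ∀ j, Δ j y = f y j) ∧
      ∀ j, ∀ y ∈ M.histories i, |Δ j y - p.2 i j y| ≤ 1 / ((m : ℝ) + 1) := by
    intro m i
    obtain ⟨g, hg, h⟩ := exists_neuralNetworks_near hφ (M.isCompact_histories i)
      (M.histories_nonempty i) hB hL (f := p.2 i) (fun j y _ z _ => (hp.2 i j).1 y z)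
      (fun j => (hp.2 i j).2) (ε := 1 / ((m : ℝ) + 1)) (by positivity)
    -- The network is controlled only on Ωᵢ, whereas an admissible position is L-Lipschitz on the
    -- whole space: a Lipschitz extension of its restriction to Ωᵢ serves as the position.
    have hext : ∀ j, ∃ Δ : EuclideanSpace ℝ (Fin (i : ℕ) × Fin d) → ℝ,
        LipschitzWith L.toNNReal Δ ∧ Set.EqOn (fun y => g y j) Δ (M.histories i) := fun j => by
      refine LipschitzOnWith.extend_real (LipschitzOnWith.of_dist_le_mul fun y hy z hz => ?_)
      rw [Real.dist_eq, dist_eq_norm, Real.coe_toNNReal _ hL.le]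
      exact (h j).1 y hy z hz
    choose Δ hΔ hΔg using hext
    refine ⟨Δ, fun j => ⟨fun y z => ?_, fun y hy => ?_⟩, ⟨g, ⟨hg, fun j => ⟨(h j).1,
      fun y hy => ((h j).2 y hy).1⟩⟩, fun y hy j => (hΔg j hy).symm⟩, fun j y hy => ?_⟩
    · have := (hΔ j).dist_le_mul y z
      rwa [Real.dist_eq, dist_eq_norm, Real.coe_toNNReal _ hL.le] at this
    · rw [← hΔg j hy]
      exact ((h j).2 y hy).1
    · rw [← hΔg j hy]
      exact ((h j).2 y hy).2
  choose Δ h1 h2 h3 using key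
  refine ⟨fun m => (p.1, Δ m), fun m => ⟨⟨hp.1, h1 m⟩, fun i _ => h2 m i⟩, tendsto_const_nhds,
    fun i j y hy => ?_⟩
  rw [tendsto_iff_dist_tendsto_zero]
  exact squeeze_zero (fun m => dist_nonneg) (fun m => h3 m i j y hy)
    tendsto_one_div_add_atTop_nhds_zero_nat

end Market

/-! ### The σ-algebra generated by the random boxes -/

namespace Market

variable {d n : ℕ} (M : Market d n)

theorem measurableSet_randomBox (U : Draws d) (i : ℕ) : MeasurableSet (M.randomBox U i) := by
  have : M.randomBox U i = ⋂ j : Fin d,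
      (fun v : PriceBox M.lo M.hi => (v j : ℝ)) ⁻¹' Set.Ioc (U i j).1 (U i j).2 := by
    ext v
    simp [randomBox]
  rw [this]
  exact MeasurableSet.iInter fun j =>
    (measurable_subtype_coe.comp (measurable_pi_apply j)) measurableSet_Ioc

theorem measurableSet_of_mem_partitions (U : Draws d) (i : ℕ) :
    ∀ E ∈ M.partitions U i, MeasurableSet E := by
  induction i with
  | zero =>
    rintro E (rfl | rfl)
    exacts [MeasurableSet.empty, MeasurableSet.univ]
  | succ i ih =>
    rintro F ⟨E, hE, rfl | rfl⟩
    · exact (ih E hE).inter (M.measurableSet_randomBox U i)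
    · exact (ih E hE).inter (M.measurableSet_randomBox U i).compl

theorem finite_partitions (U : Draws d) (i : ℕ) : (M.partitions U i).Finite := by
  induction i with
  | zero => exact (Set.finite_singleton _).insert _
  | succ i ih =>
    refine ((ih.image (· ∩ M.randomBox U i)).union (ih.image (· ∩ (M.randomBox U i)ᶜ))).subset ?_
    rintro F ⟨E, hE, rfl | rfl⟩
    · exact Or.inl ⟨E, hE, rfl⟩
    · exact Or.inr ⟨E, hE, rfl⟩

theorem sUnion_partitions (U : Draws d) (i : ℕ) : ⋃₀ M.partitions U i = Set.univ := by
  induction i with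
  | zero => simp [partitions]
  | succ i ih =>
    refine Set.eq_univ_of_forall fun v => ?_
    obtain ⟨E, hE, hv⟩ := (ih.symm ▸ Set.mem_univ v : v ∈ ⋃₀ M.partitions U i)
    by_cases h : v ∈ M.randomBox U i
    · exact ⟨_, ⟨E, hE, Or.inl rfl⟩, hv, h⟩
    · exact ⟨_, ⟨E, hE, Or.inr rfl⟩, hv, h⟩

theorem monotone_generateFrom_partitions (U : Draws d) :
    Monotone fun i => MeasurableSpace.generateFrom (M.partitions U i) := by
  refine monotone_nat_of_le_succ fun i => MeasurableSpace.generateFrom_le fun E hE => ?_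
  rw [← Set.inter_union_compl E (M.randomBox U i)]
  exact @MeasurableSet.union _ (_) _ _
    (MeasurableSpace.measurableSet_generateFrom ⟨E, hE, Or.inl rfl⟩)
    (MeasurableSpace.measurableSet_generateFrom ⟨E, hE, Or.inr rfl⟩)

theorem generateFrom_partitions_le (U : Draws d) (i : ℕ) :
    MeasurableSpace.generateFrom (M.partitions U i) ≤
      (inferInstance : MeasurableSpace (PriceBox M.lo M.hi)) :=
  MeasurableSpace.generateFrom_le (M.measurableSet_of_mem_partitions U i)

/-- The `σ`-algebra on the box of prices which is generated by all random boxes. -/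
abbrev limitSigma (U : Draws d) : MeasurableSpace (PriceBox M.lo M.hi) :=
  ⨆ i, MeasurableSpace.generateFrom (M.partitions U i)

theorem limitSigma_le (U : Draws d) :
    M.limitSigma U ≤ (inferInstance : MeasurableSpace (PriceBox M.lo M.hi)) :=
  iSup_le (M.generateFrom_partitions_le U)

theorem iSup_partitionSigma (U : Draws d) :
    ⨆ i, M.partitionSigma U i = (M.limitSigma U).comap M.terminal :=
  MeasurableSpace.comap_iSup.symm

theorem measurableSet_limitSigma_randomBox (U : Draws d) (i : ℕ) :
    MeasurableSet[M.limitSigma U] (M.randomBox U i) := by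
  -- Box i first splits the partition with index i + 1; the box is the finite union of its
  -- intersections with the members of the previous partition.
  refine le_iSup (fun i => MeasurableSpace.generateFrom (M.partitions U i)) (i + 1) _ ?_
  rw [← Set.univ_inter (M.randomBox U i), ← M.sUnion_partitions U i, Set.sUnion_eq_biUnion,
    Set.iUnion₂_inter]
  exact @MeasurableSet.biUnion _ _ (_) _ _ (M.finite_partitions U i).countable fun E hE =>
    MeasurableSpace.measurableSet_generateFrom ⟨E, hE, Or.inl rfl⟩

/-- The right end points of the draws are the upper price bounds, and the left end points are dense
in the box of prices. -/
def GenericDraws (U : Draws d) : Prop :=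
  (∀ i j, (U i j).2 = M.hi j) ∧ ∀ v w : Fin d → ℝ, (∀ j, M.lo j ≤ v j ∧ v j < w j ∧ w j ≤ M.hi j) →
    ∃ i, ∀ j, (U i j).1 ∈ Set.Ioo (v j) (w j)

variable {M} in
-- The set is a countable union of random boxes: for x in it, density puts some left end point
-- strictly between v and x, while the right end points are maximal.
theorem GenericDraws.measurableSet_upperBox {U : Draws d} (hU : M.GenericDraws U) {v : Fin d → ℝ}
    (hv : ∀ j, M.lo j ≤ v j) :
    MeasurableSet[M.limitSigma U] {x : PriceBox M.lo M.hi | ∀ j, v j < x j} := by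
  have : {x : PriceBox M.lo M.hi | ∀ j, v j < x j} =
      ⋃ i ∈ {i | ∀ j, v j ≤ (U i j).1}, M.randomBox U i := by
    ext x
    simp only [Set.mem_ofPred_eq, Set.mem_iUnion, exists_prop]
    constructor
    · intro hx
      obtain ⟨i, hi⟩ := hU.2 v (fun j => x j) fun j => ⟨hv j, hx j, (x j).2.2⟩
      exact ⟨i, fun j => (hi j).1.le, fun j => ⟨(hi j).2, by rw [hU.1]; exact (x j).2.2⟩⟩
    · rintro ⟨i, hi, hx⟩ j
      exact (hi j).trans_lt (hx j).1
  rw [this]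
  exact @MeasurableSet.biUnion _ _ (_) _ _ (Set.to_countable _) fun i _ =>
    M.measurableSet_limitSigma_randomBox U i

/-- The box of prices without its lower faces. -/
def upperPart : Set (PriceBox M.lo M.hi) := {x | ∀ j, M.lo j < x j}

variable {M} in
theorem GenericDraws.measurableSet_upperPart {U : Draws d} (hU : M.GenericDraws U) :
    MeasurableSet[M.limitSigma U] M.upperPart :=
  hU.measurableSet_upperBox fun _ => le_rfl

variable {M} in
-- It suffices that the coordinates are measurable for the trace σ-algebra on the upper part. There
-- {x_j > t} is an upper box with corner max t (lo j) in direction j and the lower bounds elsewhere.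
theorem GenericDraws.measurableSet_inter_upperPart {U : Draws d} (hU : M.GenericDraws U)
    {A : Set (PriceBox M.lo M.hi)} (hA : MeasurableSet A) :
    MeasurableSet[M.limitSigma U] (A ∩ M.upperPart) := by
  let ι : M.upperPart → PriceBox M.lo M.hi := Subtype.val
  have hι : @Measurable _ _ ((M.limitSigma U).comap ι) _ ι := by
    refine @measurable_pi_iff _ _ _ ((M.limitSigma U).comap ι) _ _ |>.2 fun j => ?_
    refine @Measurable.subtype_mk _ _ ((M.limitSigma U).comap ι) _ _ _ ?_ fun x => (ι x j).2
    refine @measurable_of_Ioi _ _ _ _ _ ((M.limitSigma U).comap ι) _ _ _ _ fun t => ?_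
    refine ⟨_, hU.measurableSet_upperBox (v := Function.update M.lo j (max t (M.lo j))) ?_, ?_⟩
    · intro k
      rcases eq_or_ne k j with rfl | hk
      · simp
      · simp [hk]
    · ext x
      simp only [Set.mem_preimage, Set.mem_ofPred_eq, Set.mem_Ioi]
      constructor
      · intro h
        have := h j
        simp only [Function.update_self, max_lt_iff] at this
        exact this.1
      · intro h k
        rcases eq_or_ne k j with rfl | hk
        · simpa using ⟨h, x.2 k⟩
        · simpa [hk] using x.2 k
  obtain ⟨A', hA', h⟩ := hι hA
  have : A ∩ M.upperPart = A' ∩ M.upperPart := by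
    ext x
    constructor
    · rintro ⟨h1, h2⟩
      have : (⟨x, h2⟩ : M.upperPart) ∈ ι ⁻¹' A' := by rw [h]; exact h1
      exact ⟨this, h2⟩
    · rintro ⟨h1, h2⟩
      have : (⟨x, h2⟩ : M.upperPart) ∈ ι ⁻¹' A := by rw [← h]; exact h1
      exact ⟨this, h2⟩
  rw [this]
  exact @MeasurableSet.inter _ (_) _ _ hA' hU.measurableSet_upperPart

variable {M} in
-- Boxes open on the left miss the lower faces. For d ≥ 2 these are P-null and can be discarded. For
-- d ≤ 1 they form at most one point, so A contains all or nothing of them and no null set is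
-- needed.
theorem GenericDraws.exists_measurableSet_ae_eq {U : Draws d} (hU : M.GenericDraws U)
    (P : Measure M.Omega)
    (hface : 2 ≤ d → ∀ j : Fin d, P {x | (M.terminal x j : ℝ) = M.lo j} = 0)
    {A : Set (PriceBox M.lo M.hi)} (hA : MeasurableSet A) :
    ∃ A', MeasurableSet[M.limitSigma U] A' ∧ M.terminal ⁻¹' A' =ᵐ[P] M.terminal ⁻¹' A := by
  by_cases hd : 2 ≤ d
  · refine ⟨_, hU.measurableSet_inter_upperPart hA, ?_⟩
    have : ∀ᵐ x ∂P, ∀ j, (M.terminal x j : ℝ) ≠ M.lo j :=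
      eventually_all.2 fun j => by simpa [ae_iff] using hface hd j
    filter_upwards [this] with x hx
    refine propext ⟨fun h => h.1, fun h => ⟨h, fun j => ?_⟩⟩
    exact lt_of_le_of_ne (M.terminal x j).2.1 (hx j).symm
  · refine ⟨A, ?_, ae_eq_rfl⟩
    have hsub : ∀ x ∈ M.upperPartᶜ, ∀ y ∈ M.upperPartᶜ, x = y := by
      intro x hx y hy
      simp only [upperPart, Set.mem_compl_iff, Set.mem_ofPred_eq, not_forall, not_lt] at hx hy
      obtain ⟨j, hj⟩ := hx
      obtain ⟨k, hk⟩ := hy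
      have : Subsingleton (Fin d) := Fin.subsingleton_iff_le_one.2 (by omega)
      ext l
      rw [Subsingleton.elim l j]
      rw [Subsingleton.elim k j] at hk
      exact (le_antisymm hj (x j).2.1).trans (le_antisymm hk (y j).2.1).symm
    rw [← Set.inter_union_compl A M.upperPart]
    refine @MeasurableSet.union _ (_) _ _ (hU.measurableSet_inter_upperPart hA) ?_
    have hc := @MeasurableSet.compl _ _ (_) hU.measurableSet_upperPart
    by_cases hne : (A ∩ M.upperPartᶜ).Nonempty
    · obtain ⟨x, hxA, hx⟩ := hne
      have : A ∩ M.upperPartᶜ = M.upperPartᶜ :=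
        Set.inter_eq_right.2 fun y hy => by rwa [hsub y hy x hx]
      rwa [this]
    · rw [Set.not_nonempty_iff_eq_empty.1 hne]
      exact @MeasurableSet.empty _ (_)

theorem uniformLaw_Ioo_pos (j : Fin d) {a b : ℝ} (ha : M.lo j ≤ a) (hab : a < b)
    (hb : b ≤ M.hi j) : 0 < M.uniformLaw j (Set.Ioo a b) := by
  rw [uniformLaw, cond_apply measurableSet_Icc,
    Set.inter_eq_right.2 (Set.Ioo_subset_Icc_self.trans (Set.Icc_subset_Icc ha hb))]
  exact ENNReal.mul_pos (by simp) (by simp [hab])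

/-- A rational box has positive probability p, so the first N independent draws all miss it with
probability (1 - p)^N → 0. There are countably many rational boxes, and every real one contains a
rational one. -/
theorem ae_genericDraws : ∀ᵐ U ∂M.drawLaw, M.GenericDraws U := by
  let ν : Measure (Fin d → ℝ × ℝ) :=
    Measure.pi fun j : Fin d => (M.uniformLaw j).prod (Measure.dirac (M.hi j))
  have h1 : ∀ᵐ U ∂M.drawLaw, ∀ i j, (U i j).2 = M.hi j := by
    refine ae_all_iff.2 fun i => ae_all_iff.2 fun j => ?_
    have hq := ((measurePreserving_eval_infinitePi (fun _ : ℕ => ν) i).quasiMeasurePreserving.ae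
      (p := fun z => (z j).2 = M.hi j) ?_)
    · exact hq
    · refine (measurePreserving_eval (fun j : Fin d =>
        (M.uniformLaw j).prod (Measure.dirac (M.hi j))) j).quasiMeasurePreserving.ae
        (p := fun z => z.2 = M.hi j) ?_
      refine Measure.quasiMeasurePreserving_snd.ae (p := fun z => z = M.hi j) ?_
      exact ae_dirac_eq (a := M.hi j) ▸ rfl
  have h2 : ∀ r s : Fin d → ℚ, (∀ j, M.lo j ≤ r j ∧ (r j : ℝ) < s j ∧ s j ≤ M.hi j) →
      ∀ᵐ U ∂M.drawLaw, ∃ i, ∀ j, (U i j).1 ∈ Set.Ioo (r j : ℝ) (s j) := by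
    intro r s hrs
    let O : Set (Fin d → ℝ × ℝ) := Set.univ.pi fun j => Set.Ioo (r j : ℝ) (s j) ×ˢ Set.univ
    have hO : MeasurableSet O :=
      MeasurableSet.univ_pi fun j => measurableSet_Ioo.prod MeasurableSet.univ
    have hpos : ν O ≠ 0 := by
      rw [Measure.pi_pi]
      refine Finset.prod_ne_zero_iff.2 fun j _ => ?_
      rw [Measure.prod_prod, measure_univ, mul_one]
      exact (M.uniformLaw_Ioo_pos j (hrs j).1 (hrs j).2.1 (hrs j).2.2).ne'
    have hlt : ν Oᶜ < 1 := by
      rw [prob_compl_eq_one_sub hO]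
      exact ENNReal.sub_lt_self ENNReal.one_ne_top one_ne_zero hpos
    rw [ae_iff]
    refine le_antisymm (ge_of_tendsto' (ENNReal.tendsto_pow_atTop_nhds_zero_of_lt_one hlt)
      fun N => ?_) bot_le
    calc M.drawLaw {U | ¬∃ i, ∀ j, (U i j).1 ∈ Set.Ioo (r j : ℝ) (s j)}
        ≤ M.drawLaw (Set.pi (Finset.range N) fun _ => Oᶜ) := by
          refine measure_mono fun U hU i _ hUO => hU ⟨i, fun j => ?_⟩
          exact (hUO j (Set.mem_univ j)).1
      _ = ν Oᶜ ^ N := by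
          rw [drawLaw, Measure.infinitePi_pi _ fun _ _ => hO.compl]
          simp [ν]
  have h3 : ∀ᵐ U ∂M.drawLaw, ∀ r s : Fin d → ℚ,
      (∀ j, M.lo j ≤ r j ∧ (r j : ℝ) < s j ∧ s j ≤ M.hi j) →
      ∃ i, ∀ j, (U i j).1 ∈ Set.Ioo (r j : ℝ) (s j) := by
    refine ae_all_iff.2 fun r => ae_all_iff.2 fun s => ?_
    by_cases h : ∀ j, M.lo j ≤ r j ∧ (r j : ℝ) < s j ∧ s j ≤ M.hi j
    · filter_upwards [h2 r s h] with U hU _ using hU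
    · exact Eventually.of_forall fun U h' => absurd h' h
  filter_upwards [h1, h3] with U hU1 hU3
  refine ⟨hU1, fun v w hvw => ?_⟩
  choose r hr using fun j => exists_rat_btwn (hvw j).2.1
  choose s hs using fun j => exists_rat_btwn (hr j).2
  obtain ⟨i, hi⟩ := hU3 r s fun j =>
    ⟨(hvw j).1.trans (hr j).1.le, (hs j).1, (hs j).2.le.trans (hvw j).2.2⟩
  exact ⟨i, fun j => ⟨(hr j).1.trans (hi j).1, (hi j).2.trans (hs j).2⟩⟩

end Market

/-! ### Convergence of conditional expectations and penalties -/

/-- Conditional expectations given two nested `σ`-algebras agree if the larger one is contained in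
the completion of the smaller one. -/
theorem condExp_ae_eq_of_ae_eq_measurableSet {Ω : Type*} {m₁ m₂ m₀ : MeasurableSpace Ω}
    (h12 : m₁ ≤ m₂) (h2 : m₂ ≤ m₀) (P : Measure Ω) [IsProbabilityMeasure P]
    (h : ∀ s, MeasurableSet[m₂] s → ∃ t, MeasurableSet[m₁] t ∧ t =ᵐ[P] s) {X : Ω → ℝ}
    (hX : Integrable X P) : P[X | m₁] =ᵐ[P] P[X | m₂] := by
  refine ae_eq_condExp_of_forall_setIntegral_eq h2 hX
    (fun _ _ _ => integrable_condExp.integrableOn) (fun s hs _ => ?_)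
    (stronglyMeasurable_condExp.mono h12).aestronglyMeasurable
  obtain ⟨t, ht, hts⟩ := h s hs
  rw [← setIntegral_congr_set hts, ← setIntegral_congr_set hts,
    setIntegral_condExp (h12.trans h2) hX ht]

namespace Market

variable {d n : ℕ} {M : Market d n}

theorem partitionSigma_le (U : Draws d) (i : ℕ) :
    M.partitionSigma U i ≤ (inferInstance : MeasurableSpace M.Omega) :=
  (MeasurableSpace.comap_mono (M.generateFrom_partitions_le U i)).trans
    M.measurable_terminal.comap_le

/-- Lévy's upward theorem for the random partitions. -/
theorem GenericDraws.tendsto_eLpNorm_condExp {U : Draws d} (hU : M.GenericDraws U)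
    (P : Measure M.Omega) [IsProbabilityMeasure P]
    (hface : 2 ≤ d → ∀ j : Fin d, P {x | (M.terminal x j : ℝ) = M.lo j} = 0)
    {X : M.Omega → ℝ} (hX : Integrable X P) :
    Tendsto (fun i => eLpNorm (P[X | M.partitionSigma U i] - P[X | M.terminalSigma]) 1 P)
      atTop (𝓝 0) := by
  let ℱ : Filtration ℕ (inferInstance : MeasurableSpace M.Omega) :=
    { seq := M.partitionSigma U
      mono' := fun i k hik => MeasurableSpace.comap_mono (M.monotone_generateFrom_partitions U hik)
      le' := partitionSigma_le U }
  have hsup : ⨆ i, ℱ i = (M.limitSigma U).comap M.terminal := M.iSup_partitionSigma U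
  -- Lévy's theorem yields the conditional expectation given all boxes; up to null sets these
  -- generate σ(S_{tₙ}).
  have heq : P[X | ⨆ i, ℱ i] =ᵐ[P] P[X | M.terminalSigma] := by
    rw [hsup]
    refine condExp_ae_eq_of_ae_eq_measurableSet (MeasurableSpace.comap_mono (M.limitSigma_le U))
      M.measurable_terminal.comap_le P ?_ hX
    rintro s ⟨A, hA, rfl⟩
    obtain ⟨A', hA', h⟩ := hU.exists_measurableSet_ae_eq P hface hA
    exact ⟨_, ⟨A', hA', rfl⟩, h⟩
  refine (MeasureTheory.tendsto_eLpNorm_condExp (ℱ := ℱ) X).congr fun i => eLpNorm_congr_ae ?_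
  exact EventuallyEq.rfl.sub heq

end Market

/-- Penalties are continuous with respect to bounded pointwise convergence of the position and `L¹`
convergence of the conditional expectations of the limit. -/
theorem tendsto_condPenalty {Ω : Type} {𝒢 : ℕ → MeasurableSpace Ω} {ℋ m₀ : MeasurableSpace Ω}
    (P : ProbabilityMeasure Ω)
    {β : ℝ → ℝ} (hβ : Continuous β) {X : ℕ → Ω → ℝ} {Y : Ω → ℝ} {R : ℝ}
    (hX : ∀ m, Measurable (X m)) (hXR : ∀ m x, |X m x| ≤ R)
    (hXY : ∀ x, Tendsto (fun m => X m x) atTop (𝓝 (Y x)))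
    (hY : Tendsto (fun m => eLpNorm (P.toMeasure[Y | 𝒢 m] - P.toMeasure[Y | ℋ]) 1 P.toMeasure)
      atTop (𝓝 0)) :
    Tendsto (fun m => condPenalty β (𝒢 m) P (X m)) atTop (𝓝 (condPenalty β ℋ P Y)) := by
  set μ := P.toMeasure with hμ
  have hYm : Measurable Y := measurable_of_tendsto_metrizable hX (tendsto_pi_nhds.2 hXY)
  have hYR : ∀ x, |Y x| ≤ R := fun x => le_of_tendsto (hXY x).abs
    (Eventually.of_forall fun m => hXR m x)
  have hXi : ∀ m, Integrable (X m) μ := fun m =>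
    Integrable.of_bound (hX m).aestronglyMeasurable R (Eventually.of_forall (hXR m))
  have hYi : Integrable Y μ :=
    Integrable.of_bound hYm.aestronglyMeasurable R (Eventually.of_forall hYR)
  have hdiff : Tendsto (fun m => eLpNorm (X m - Y) 1 μ) atTop (𝓝 0) := by
    simp only [eLpNorm_one_eq_lintegral_enorm, Pi.sub_apply]
    have := tendsto_lintegral_norm_of_dominated_convergence (μ := μ) (bound := fun _ => R)
      (fun m => (hX m).aestronglyMeasurable) (integrable_const R).2
      (fun m => Eventually.of_forall (hXR m)) (Eventually.of_forall hXY)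
    simpa only [ofReal_norm] using this
  -- Conditional expectation contracts L¹, so replacing the m-th function by Y costs at most their
  -- L¹ distance, whatever the σ-algebra.
  have hsum : Tendsto (fun m => eLpNorm (μ[X m | 𝒢 m] - μ[Y | ℋ]) 1 μ) atTop (𝓝 0) := by
    have hle : ∀ m, eLpNorm (μ[X m | 𝒢 m] - μ[Y | ℋ]) 1 μ ≤
        eLpNorm (X m - Y) 1 μ + eLpNorm (μ[Y | 𝒢 m] - μ[Y | ℋ]) 1 μ := fun m => by
      have h1 : μ[X m | 𝒢 m] - μ[Y | ℋ] =ᵐ[μ]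
          μ[X m - Y | 𝒢 m] + (μ[Y | 𝒢 m] - μ[Y | ℋ]) := by
        filter_upwards [condExp_sub (hXi m) hYi (𝒢 m)] with x hx
        simp only [Pi.add_apply, Pi.sub_apply] at hx ⊢
        rw [hx]; ring
      rw [eLpNorm_congr_ae h1]
      refine (eLpNorm_add_le integrable_condExp.aestronglyMeasurable
        (integrable_condExp.sub integrable_condExp).aestronglyMeasurable le_rfl).trans ?_
      gcongr
      exact eLpNorm_condExp_le_eLpNorm _ le_rfl
    refine tendsto_of_tendsto_of_tendsto_of_le_of_le tendsto_const_nhds ?_ (fun _ => bot_le) hle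
    simpa using hdiff.add hY
  have hbd : ∀ m, ∀ᵐ x ∂μ, |(μ[X m | 𝒢 m]) x| ≤ R := fun m =>
    ae_bdd_abs_condExp_of_ae_bdd_abs (Eventually.of_forall (hXR m))
  have hmeas : TendstoInMeasure μ (fun m => μ[X m | 𝒢 m]) atTop (μ[Y | ℋ]) :=
    tendstoInMeasure_of_tendsto_eLpNorm one_ne_zero
      (fun m => integrable_condExp.aestronglyMeasurable) integrable_condExp.aestronglyMeasurable hsum
  obtain ⟨C, hC⟩ := (isCompact_Icc (a := -R) (b := R)).exists_bound_of_continuousOn hβ.continuousOn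
  -- Convergence in measure gives almost sure convergence along a further subsequence, and there β
  -- of the conditional expectations is dominated by its bound on [-R, R].
  refine tendsto_of_subseq_tendsto fun ns hns => ?_
  obtain ⟨ms, -, hms⟩ := (hmeas.comp hns).exists_seq_tendsto_ae
  refine ⟨ms, tendsto_integral_of_dominated_convergence (fun _ => C) (fun m => ?_)
    (integrable_const C) (fun m => ?_) ?_⟩
  · exact hβ.comp_aestronglyMeasurable integrable_condExp.aestronglyMeasurable
  · filter_upwards [hbd (ns (ms m))] with x hx using hC _ (abs_le.1 hx)
  · filter_upwards [hms] with x hx using (hβ.tendsto _).comp hx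

/-! ### Convergence of infima and zero penalties -/

/-- A convergence criterion for infima, in the manner of Gamma-convergence. -/
theorem tendsto_biInf_of_forall {α : Type*} {S T : Set α} {F : ℕ → α → ℝ} {G : α → ℝ}
    (hsup : ∀ p ∈ T, ∀ a, G p < a → ∃ q ∈ S, ∀ᶠ i in atTop, F i q < a)
    (hinf : ∀ (a : ℝ) (ns : ℕ → ℕ) (q : ℕ → α), StrictMono ns → (∀ m, q m ∈ S) →
      (∀ m, F (ns m) (q m) ≤ a) → ∃ p ∈ T, G p ≤ a) :
    Tendsto (fun i => ⨅ p ∈ S, ((F i p : ℝ) : EReal)) atTop (𝓝 (⨅ p ∈ T, ((G p : ℝ) : EReal))) := by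
  refine tendsto_order.2 ⟨fun a ha => ?_, fun a ha => ?_⟩
  · obtain ⟨r, har, hr⟩ := EReal.lt_iff_exists_real_btwn.1 ha
    by_contra hcon
    -- If the infima fell to `a` or below infinitely often, points of cost at most r would exist
    -- along a subsequence, and `hinf` would put the limit infimum at most r.
    have hfreq : ∃ᶠ i in atTop, ∃ q ∈ S, F i q ≤ r := by
      refine (not_eventually.1 hcon).mono fun i hi => ?_
      have : (⨅ p ∈ S, ((F i p : ℝ) : EReal)) < r := (not_lt.1 hi).trans_lt har
      obtain ⟨q, hq, h⟩ := by simpa only [iInf_lt_iff, exists_prop] using this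
      exact ⟨q, hq, (EReal.coe_lt_coe_iff.1 h).le⟩
    obtain ⟨ns, hns, h⟩ := extraction_of_frequently_atTop hfreq
    choose q hq hqr using h
    obtain ⟨p, hp, hpr⟩ := hinf r ns q hns hq hqr
    exact absurd (hr.trans_le (iInf₂_le p hp)) (not_lt.2 (EReal.coe_le_coe_iff.2 hpr))
  · obtain ⟨p, hp, hpa⟩ := by simpa only [iInf_lt_iff, exists_prop] using ha
    obtain ⟨r, hpr, hra⟩ := EReal.lt_iff_exists_real_btwn.1 hpa
    obtain ⟨q, hq, h⟩ := hsup p hp r (EReal.coe_lt_coe_iff.1 hpr)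
    filter_upwards [h] with i hi
    exact (iInf₂_le q hq).trans_lt ((EReal.coe_lt_coe_iff.2 hi).trans hra)

theorem IsPenalty.nonneg {β : ℝ → ℝ} (hβ : IsPenalty β) (x : ℝ) : 0 ≤ β x := by
  rcases le_or_gt x 0 with h | h
  · exact (hβ.2.1 x h).ge
  · exact (hβ.2.2 x h).le

theorem IsPenalty.le_zero {β : ℝ → ℝ} (hβ : IsPenalty β) {x : ℝ} (h : β x = 0) : x ≤ 0 :=
  not_lt.1 fun hx => (hβ.2.2 x hx).ne' h

theorem condPenalty_nonneg {Ω : Type} (𝒢 : MeasurableSpace Ω) {m₀ : MeasurableSpace Ω}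
    (P : ProbabilityMeasure Ω) {β : ℝ → ℝ} (hβ : IsPenalty β) (X : Ω → ℝ) :
    0 ≤ condPenalty β 𝒢 P X :=
  integral_nonneg fun _ => hβ.nonneg _

/-- The penalty vanishes exactly for conditional super-replication. -/
theorem condPenalty_eq_zero_iff {Ω : Type} (𝒢 : MeasurableSpace Ω) {m₀ : MeasurableSpace Ω}
    (P : ProbabilityMeasure Ω) {β : ℝ → ℝ} (hβ : IsPenalty β) {h Φ : Ω → ℝ} {R : ℝ}
    (hh : Measurable h) (hΦ : Measurable Φ) (hhR : ∀ x, |h x| ≤ R) (hΦR : ∀ x, |Φ x| ≤ R) :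
    condPenalty β 𝒢 P (fun x => Φ x - h x) = 0 ↔ CondDominates 𝒢 P h Φ := by
  set μ := P.toMeasure with hμ
  have hi : Integrable h μ :=
    Integrable.of_bound hh.aestronglyMeasurable R (Eventually.of_forall hhR)
  have hΦi : Integrable Φ μ :=
    Integrable.of_bound hΦ.aestronglyMeasurable R (Eventually.of_forall hΦR)
  have hsub := condExp_sub hΦi hi 𝒢
  obtain ⟨C, hC⟩ := (isCompact_Icc (a := -(R + R)) (b := R + R)).exists_bound_of_continuousOn
    hβ.1.continuousOn
  have hbd : ∀ᵐ x ∂μ, |(μ[Φ - h | 𝒢]) x| ≤ R + R :=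
    ae_bdd_abs_condExp_of_ae_bdd_abs (Eventually.of_forall fun x =>
      (abs_sub _ _).trans (add_le_add (hΦR x) (hhR x)))
  have hint : Integrable (fun x => β ((μ[Φ - h | 𝒢]) x)) μ := by
    refine Integrable.of_bound
      (hβ.1.comp_aestronglyMeasurable integrable_condExp.aestronglyMeasurable) C ?_
    filter_upwards [hbd] with x hx using hC _ (abs_le.1 hx)
  have : condPenalty β 𝒢 P (fun x => Φ x - h x) = ∫ x, β ((μ[Φ - h | 𝒢]) x) ∂μ := rfl
  rw [this, integral_eq_zero_iff_of_nonneg (fun _ => hβ.nonneg _) hint]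
  constructor
  · intro h0
    filter_upwards [h0, hsub] with x hx hs
    have h1 := hβ.le_zero hx
    rw [hs, Pi.sub_apply] at h1
    linarith
  · intro h0
    filter_upwards [h0, hsub] with x hx hs
    show β _ = 0
    rw [hs]
    exact hβ.2.1 _ (sub_nonpos.2 hx)

namespace Market

variable {d n : ℕ} {M : Market d n}

theorem tendsto_condPenalty_payoff (hcont : M.ContinuousCosts) (hbdd : M.LocallyBoundedCosts)
    (P : ProbabilityMeasure M.Omega) {β : ℝ → ℝ} (hβ : Continuous β) {B L : ℝ} (hB : 0 ≤ B)
    {Φ : M.Omega → ℝ} (hΦ : Measurable Φ) (hΦB : ∀ x, |Φ x| ≤ B)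
    {q : ℕ → ℝ × Strategy d n} (hq : ∀ m, q m ∈ M.admissible B L) {p : ℝ × Strategy d n}
    (hqp : M.ConvergesTo q p) {𝒢 : ℕ → MeasurableSpace M.Omega}
    (h𝒢 : Tendsto (fun m => eLpNorm (P.toMeasure[fun x => Φ x - M.payoff p x | 𝒢 m]
      - P.toMeasure[fun x => Φ x - M.payoff p x | M.terminalSigma]) 1 P.toMeasure) atTop (𝓝 0)) :
    Tendsto (fun m => condPenalty β (𝒢 m) P fun x => Φ x - M.payoff (q m) x) atTop
      (𝓝 (condPenalty β M.terminalSigma P fun x => Φ x - M.payoff p x)) := by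
  obtain ⟨R, hR⟩ := exists_abs_payoff_le hbdd hB L
  exact tendsto_condPenalty P hβ
    (fun m => hΦ.sub (M.measurable_payoff (continuous_of_mem_admissible (hq m))))
    (R := B + R) (fun m x => (abs_sub _ _).trans (add_le_add (hΦB x) (hR _ (hq m) x)))
    (fun x => tendsto_const_nhds.sub (hqp.payoff hcont x)) h𝒢

end Market

/-! ### The limits in the partition and in the penalty weight -/

namespace Market

variable {d n : ℕ} {M : Market d n}

theorem tendsto_penalizedCost (hcont : M.ContinuousCosts) (hbdd : M.LocallyBoundedCosts)
    (Ps : Finset (ProbabilityMeasure M.Omega)) {β : ℝ → ℝ} (hβ : Continuous β) {B L : ℝ}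
    (hB : 0 ≤ B) {Φ : M.Omega → ℝ} (hΦ : Measurable Φ) (hΦB : ∀ x, |Φ x| ≤ B) (k : ℕ)
    {q : ℕ → ℝ × Strategy d n} (hq : ∀ m, q m ∈ M.admissible B L) {p : ℝ × Strategy d n}
    (hqp : M.ConvergesTo q p) {𝒢 : ℕ → MeasurableSpace M.Omega}
    (h𝒢 : ∀ P ∈ Ps, Tendsto (fun m => eLpNorm (P.toMeasure[fun x => Φ x - M.payoff p x | 𝒢 m]
      - P.toMeasure[fun x => Φ x - M.payoff p x | M.terminalSigma]) 1 P.toMeasure) atTop (𝓝 0)) :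
    Tendsto (fun m => M.penalizedCost Ps β k Φ (𝒢 m) (q m)) atTop
      (𝓝 (M.penalizedCost Ps β k Φ M.terminalSigma p)) :=
  hqp.1.add (tendsto_const_nhds.mul (tendsto_finsetSum _ fun P hP =>
    tendsto_condPenalty_payoff hcont hbdd P hβ hB hΦ hΦB hq hqp (h𝒢 P hP)))

theorem sum_condPenalty_nonneg {β : ℝ → ℝ} (hβ : IsPenalty β)
    (Ps : Finset (ProbabilityMeasure M.Omega)) (X : M.Omega → ℝ) :
    0 ≤ ∑ P ∈ Ps, condPenalty β M.terminalSigma P X :=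
  Finset.sum_nonneg fun P _ => condPenalty_nonneg _ P hβ X

/-- The penalized prices converge to the super-replication price as the penalty explodes. -/
theorem tendsto_penalizedPrice_superRepPrice (hcont : M.ContinuousCosts)
    (hbdd : M.LocallyBoundedCosts) (Ps : Finset (ProbabilityMeasure M.Omega)) {β : ℝ → ℝ}
    (hβ : IsPenalty β) {B L : ℝ} (hB : 0 < B) (hL : 0 < L) {Φ : M.Omega → ℝ} (hΦ : Measurable Φ)
    (hΦB : ∀ x, |Φ x| ≤ B) :
    Tendsto (fun k : ℕ => ⨅ p ∈ M.admissible B L,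
        ((M.penalizedCost Ps β k Φ M.terminalSigma p : ℝ) : EReal)) atTop
      (𝓝 (M.superRepPrice (Ps : Set (ProbabilityMeasure M.Omega)) B L Φ M.terminalSigma)) := by
  obtain ⟨R, hR⟩ := exists_abs_payoff_le hbdd hB.le L
  have iff : ∀ p ∈ M.admissible B L, ∀ P : ProbabilityMeasure M.Omega,
      condPenalty β M.terminalSigma P (fun x => Φ x - M.payoff p x) = 0 ↔
        CondDominates M.terminalSigma P (M.payoff p) Φ := fun p hp P =>
    condPenalty_eq_zero_iff _ P hβ (R := max R B)
      (M.measurable_payoff (continuous_of_mem_admissible hp)) hΦ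
      (fun x => (hR p hp x).trans (le_max_left _ _)) (fun x => (hΦB x).trans (le_max_right _ _))
  refine tendsto_biInf_of_forall (G := fun p : ℝ × Strategy d n => p.1) ?_ ?_
  · rintro p ⟨hp, hdom⟩ a ha
    refine ⟨p, hp, Eventually.of_forall fun k => ?_⟩
    rwa [penalizedCost, Finset.sum_eq_zero fun P hP => (iff p hp P).2 (hdom P hP), mul_zero,
      add_zero]
  · intro a ns q hns hq hle
    obtain ⟨ms, hms, p, hp, hqp⟩ := exists_subseq_convergesTo hL hq
    let J : ℝ × Strategy d n → ℝ := fun p =>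
      ∑ P ∈ Ps, condPenalty β M.terminalSigma P fun x => Φ x - M.payoff p x
    have hJ0 : ∀ p, 0 ≤ J p := fun p => sum_condPenalty_nonneg hβ Ps _
    have hJ : Tendsto (fun m => J (q (ms m))) atTop (𝓝 (J p)) :=
      tendsto_finsetSum _ fun P _ => tendsto_condPenalty_payoff hcont hbdd P hβ.1 hB.le hΦ hΦB
        (fun m => hq (ms m)) hqp (by simp)
    have hcost : ∀ m, (q m).1 + ns m * J (q m) ≤ a := hle
    have hN : Tendsto (fun m => ((ns (ms m) : ℕ) : ℝ)) atTop atTop :=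
      tendsto_natCast_atTop_atTop.comp (hns.comp hms).tendsto_atTop
    -- Since the initial capital is at least -B, a cost at most a bounds the penalty by (a + B)/k,
    -- which tends to 0 along the subsequence.
    have hJp : J p ≤ 0 := by
      refine le_of_tendsto_of_tendsto hJ (hN.const_div_atTop (a + B)) ?_
      filter_upwards [hN.eventually_gt_atTop 0] with m hm
      show J (q (ms m)) ≤ (a + B) / (ns (ms m) : ℕ)
      rw [le_div_iff₀ hm]
      linarith [hcost (ms m), (abs_le.1 (hq (ms m)).1).1]
    refine ⟨p, ⟨hp, fun P hP => (iff p hp P).1 ?_⟩, le_of_tendsto hqp.1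
      (Eventually.of_forall fun m => ?_)⟩
    · exact (Finset.sum_eq_zero_iff_of_nonneg fun P _ => condPenalty_nonneg _ P hβ _).1
        (le_antisymm hJp (hJ0 p)) P hP
    · linarith [hcost (ms m), mul_nonneg (Nat.cast_nonneg (α := ℝ) (ns (ms m))) (hJ0 (q (ms m)))]

/-- Convergence of the penalized prices over networks along the random partitions. -/
theorem GenericDraws.tendsto_nnPenalizedPrice {U : Draws d} (hU : M.GenericDraws U)
    (hcont : M.ContinuousCosts) (hbdd : M.LocallyBoundedCosts)
    (Ps : Finset (ProbabilityMeasure M.Omega))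
    (hface : 2 ≤ d → ∀ P ∈ Ps, ∀ j : Fin d,
      P.toMeasure {x | (M.terminal x j : ℝ) = M.lo j} = 0)
    {β φ : ℝ → ℝ} (hβ : Continuous β) (hφ : IsAdmissibleActivation φ) {B L : ℝ} (hB : 0 < B)
    (hL : 0 < L) {Φ : M.Omega → ℝ} (hΦ : Measurable Φ) (hΦB : ∀ x, |Φ x| ≤ B) (k : ℕ) :
    Tendsto (fun i : ℕ => M.nnPenalizedPrice Ps β φ B L k Φ (M.partitionSigma U i)) atTop
      (𝓝 (⨅ p ∈ M.admissible B L,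
        ((M.penalizedCost Ps β k Φ M.terminalSigma p : ℝ) : EReal))) := by
  obtain ⟨R, hR⟩ := exists_abs_payoff_le hbdd hB.le L
  have levy : ∀ p ∈ M.admissible B L, ∀ P ∈ Ps, Tendsto (fun i => eLpNorm
      (P.toMeasure[fun x => Φ x - M.payoff p x | M.partitionSigma U i]
        - P.toMeasure[fun x => Φ x - M.payoff p x | M.terminalSigma]) 1 P.toMeasure)
      atTop (𝓝 0) := fun p hp P hP => by
    refine hU.tendsto_eLpNorm_condExp P.toMeasure (fun h2 => hface h2 P hP) ?_
    exact Integrable.of_bound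
      (hΦ.sub (M.measurable_payoff (continuous_of_mem_admissible hp))).aestronglyMeasurable (B + R)
      (Eventually.of_forall fun x => (abs_sub _ _).trans (add_le_add (hΦB x) (hR p hp x)))
  refine tendsto_biInf_of_forall ?_ ?_
  · intro p hp a ha
    obtain ⟨q, hq, hqp⟩ := exists_nnAdmissible_convergesTo hφ hB hL hp
    -- The limits are taken in turn: a network strategy is chosen under the limit σ-algebra, then
    -- kept fixed while the partitions are refined.
    have h1 := tendsto_penalizedCost hcont hbdd Ps hβ hB.le hΦ hΦB k (fun m => (hq m).1) hqp
      (𝒢 := fun _ => M.terminalSigma) (by simp)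
    obtain ⟨m, hm⟩ := (h1.eventually (gt_mem_nhds ha)).exists
    have h2 := tendsto_penalizedCost hcont hbdd Ps hβ hB.le hΦ hΦB k (q := fun _ => q m)
      (fun _ => (hq m).1) (p := q m) ⟨tendsto_const_nhds, fun _ _ _ _ => tendsto_const_nhds⟩
      (levy (q m) (hq m).1)
    exact ⟨q m, hq m, h2.eventually (gt_mem_nhds hm)⟩
  · intro a ns q hns hq hle
    -- The limit of network strategies need not be a network, which is why the limit problem runs
    -- over all admissible strategies.
    obtain ⟨ms, hms, p, hp, hqp⟩ := exists_subseq_convergesTo hL fun m => (hq m).1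
    exact ⟨p, hp, le_of_tendsto (tendsto_penalizedCost hcont hbdd Ps hβ hB.le hΦ hΦB k
      (fun m => (hq (ms m)).1) hqp
      fun P hP => (levy p hp P hP).comp (hns.comp hms).tendsto_atTop)
      (Eventually.of_forall fun m => hle (ms m))⟩

theorem zero_mem_admissible {B L : ℝ} (hB : 0 ≤ B) (hL : 0 ≤ L) :
    ((0, fun _ _ _ => 0) : ℝ × Strategy d n) ∈ M.admissible B L :=
  ⟨by simpa using hB, fun _ _ => ⟨fun y z => by simpa using mul_nonneg hL (norm_nonneg _),
    fun _ _ => by simpa using hB⟩⟩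

/-- The penalized price is a real number. -/
theorem exists_coe_eq_penalizedPrice (Ps : Finset (ProbabilityMeasure M.Omega)) {β : ℝ → ℝ}
    (hβ : IsPenalty β) {B L : ℝ} (hB : 0 ≤ B) (hL : 0 ≤ L) (Φ : M.Omega → ℝ) (k : ℕ) :
    ∃ γ : ℝ, (γ : EReal) = ⨅ p ∈ M.admissible B L,
      ((M.penalizedCost Ps β k Φ M.terminalSigma p : ℝ) : EReal) := by
  refine ⟨_, EReal.coe_toReal (ne_top_of_le_ne_top (EReal.coe_ne_top _)
    (iInf₂_le _ (zero_mem_admissible hB hL)))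
    (ne_bot_of_le_ne_bot (EReal.coe_ne_bot (-B)) (le_iInf₂ fun p hp => ?_))⟩
  refine EReal.coe_le_coe_iff.2 ?_
  have h1 := (abs_le.1 hp.1).1
  have h2 := mul_nonneg (Nat.cast_nonneg (α := ℝ) k)
    (sum_condPenalty_nonneg hβ Ps fun x => Φ x - M.payoff p x)
  unfold penalizedCost
  linarith

end Market

theorem theorem2p9 {d n : ℕ} (hd : 0 < d) (hn : 0 < n) (M : Market d n)
    (hcont : M.ContinuousCosts) (hbdd : M.LocallyBoundedCosts)
    (Ps : Finset (ProbabilityMeasure M.Omega))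
    (hface : 2 ≤ d → ∀ P ∈ Ps, ∀ j : Fin d,
      P.toMeasure {x | (M.terminal x j : ℝ) = M.lo j} = 0)
    (β : ℝ → ℝ) (hβ : IsPenalty β) (hβconv : ConvexOn ℝ Set.univ β)
    (φ : ℝ → ℝ) (hφ : IsAdmissibleActivation φ)
    (B L : ℝ) (hB : 0 < B) (hL : 0 < L)
    (Φ : M.Omega → ℝ) (hΦ : Measurable Φ) (hΦB : ∀ x, |Φ x| ≤ B) :
    ∀ᵐ U ∂M.drawLaw, ∃ γ : ℕ → ℝ,
      (∀ k : ℕ, Tendsto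
        (fun i : ℕ => M.nnPenalizedPrice Ps β φ B L k Φ (M.partitionSigma U i))
        atTop (𝓝 ((γ k : ℝ) : EReal))) ∧
      Tendsto (fun k : ℕ => ((γ k : ℝ) : EReal)) atTop
        (𝓝 (M.superRepPrice (Ps : Set (ProbabilityMeasure M.Omega)) B L Φ M.terminalSigma)) := by
  -- The inner limit is the penalized price over all admissible strategies given σ(S_{tₙ}), which
  -- does not depend on U.
  choose γ hγ using fun k => M.exists_coe_eq_penalizedPrice Ps hβ hB.le hL.le Φ k
  filter_upwards [M.ae_genericDraws] with U hU
  refine ⟨γ, fun k => ?_, ?_⟩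
  · rw [hγ k]
    exact hU.tendsto_nnPenalizedPrice hcont hbdd Ps hface hβ.1 hφ hB hL hΦ hΦB k
  · simp only [hγ]
    exact Market.tendsto_penalizedPrice_superRepPrice hcont hbdd Ps hβ hB hL hΦ hΦB
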